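/- Let $\mathbb{T}^{n}=(\mathbb{R}/2\pi\mathbb{Z})^{n}$ and give $C^\infty(\mathbb{T}^{n})$ its usual Fréchet topology. For a continuous linear operator $Q$ on $C^\infty(\mathbb{T}^n)$, its discrete symbol is $Q(y,\eta)=e^{-iy\cdot\eta}\,Q(e^{iy\cdot\eta})(y)$ for $y\in\mathbb{T}^n$, $\eta\in\mathbb{Z}^n$; $Q$ is a pseudodifferential operator of order $m\in\mathbb{R}$ if for every multi-index $\alpha$ there is $C_\alpha>0$ with $|D_y^\alpha Q(y,\eta)|\le C_\alpha(1+|\eta|)^m$ for all $y,\eta$. Write $\mathbb{T}^{N+1}=S^1_t\times\mathbb{T}^N_x$ and let $c=c(t,D_x)$ be a pseudodifferential operator of order $m$ on $\mathbb{T}^{N+1}$, where $m\ge 1$ is an integer, whose discrete symbol $c(t,\xi)$ depends only on $(t,\xi)\in S^1\times\mathbb{Z}^N$. Assume that $c$ is positively homogeneous of degree $m$, i.e. $c(t,n\xi)=n^m c(t,\xi)$ for all $t\in S^1$, $\xi\in\mathbb{Z}^N$ and integers $n\ge 1$. Put $P=D_t+c(t,D_x)$ with $D_t=-i\partial_t$,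 $b(t,\xi)=\operatorname{Im}c(t,\xi)$, $c_0(\xi)=(2\pi)^{-1}\int_0^{2\pi}c(t,\xi)\,dt$ and $B(t,\xi)=\int_0^t b(\tau,\xi)\,d\tau$. The operator $P$ is called globally solvable if its range is closed in $C^\infty(\mathbb{T}^{N+1})$. For $D>0$ and $\xi\in\mathbb{Z}^N\setminus\{0\}$, $P$ satisfies $(\alpha)_D^{+}$ (respectively $(\alpha)_D^{-}$) at $\xi$ if for every $t\in[0,2\pi]$ and every open interval $I\subset[t,t+2\pi]$ (respectively $I\subset[t-2\pi,t]$) of length $|I|\ge|\xi|^{-m}$ there is $s\in I$ with $B(t,\xi)-B(s,\xi)\le D\log|\xi|$. Suppose that there is $\xi_0\in\mathbb{Z}^N\setminus\{0\}$ such that $c_0(\xi_0)\notin\mathbb{Z}$ and $b(\cdot,\xi_0)$ changes sign, i.e. takes both a negative and a positive value. Then $P$ is not globally solvable. Moreover, for every $D>0$ there are infinitely many integers $n\ge1$ such that $c_0(n\xi_0)\notin\mathbb{Z}$ and $P$ satisfies neither $(\alpha)_D^+$ nor $(\alpha)_D^-$ at $n\xi_0$. -/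

import Mathlib

open scoped ContDiff

noncomputable section

/-! The space of smooth functions on the torus `𝕋ⁿ = (ℝ / 2πℤ)ⁿ`, with its Fréchet topology. -/

/-- A function on `ℝⁿ` that is `2π`-periodic in each variable. -/
def IsTorusPeriodic {n : ℕ} {F : Type*} (f : (Fin n → ℝ) → F) : Prop :=
  ∀ (j : Fin n) (y : Fin n → ℝ), f (y + Pi.single j (2 * Real.pi)) = f y

/-- Smooth complex functions on `𝕋ⁿ`, as `2π`-periodic smooth functions on `ℝⁿ`. -/
def smoothPeriodic (n : ℕ) : Submodule ℂ ((Fin n → ℝ) → ℂ) where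
  carrier := {f | ContDiff ℝ ∞ f ∧ IsTorusPeriodic f}
  add_mem' := fun {f g} hf hg => ⟨hf.1.add hg.1, fun j y => by
    simp only [Pi.add_apply, hf.2 j y, hg.2 j y]⟩
  zero_mem' := ⟨contDiff_const, fun _ _ => rfl⟩
  smul_mem' := fun a f hf => ⟨hf.1.const_smul a, fun j y => by
    simp only [Pi.smul_apply, hf.2 j y]⟩

/-- The space `C^∞(𝕋ⁿ)`. It is a type of its own, so that it does not inherit the topology of
pointwise convergence. -/
def TorusSmooth (n : ℕ) : Type := smoothPeriodic n

namespace TorusSmooth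

variable {n : ℕ}

instance : AddCommGroup (TorusSmooth n) := inferInstanceAs (AddCommGroup (smoothPeriodic n))

instance : Module ℂ (TorusSmooth n) := inferInstanceAs (Module ℂ (smoothPeriodic n))

instance : CoeFun (TorusSmooth n) (fun _ => (Fin n → ℝ) → ℂ) := ⟨fun f => f.1⟩

/-- The element of `C^∞(𝕋ⁿ)` given by a smooth periodic function. -/
def mk (f : (Fin n → ℝ) → ℂ) (hf : ContDiff ℝ ∞ f) (hp : IsTorusPeriodic f) : TorusSmooth n :=
  ⟨f, hf, hp⟩

theorem contDiff (f : TorusSmooth n) : ContDiff ℝ ∞ f := f.2.1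

theorem periodic (f : TorusSmooth n) : IsTorusPeriodic f := f.2.2

@[ext] theorem ext {f g : TorusSmooth n} (h : ∀ y, f y = g y) : f = g := Subtype.ext (funext h)

@[simp] theorem mk_apply (f : (Fin n → ℝ) → ℂ) (hf : ContDiff ℝ ∞ f) (hp : IsTorusPeriodic f)
    (y : Fin n → ℝ) : mk f hf hp y = f y := rfl

@[simp] theorem add_apply (f g : TorusSmooth n) (y : Fin n → ℝ) : (f + g) y = f y + g y := rfl

@[simp] theorem smul_apply (a : ℂ) (f : TorusSmooth n) (y : Fin n → ℝ) :
    (a • f) y = a * f y := rfl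

theorem coe_add (f g : TorusSmooth n) : ((f + g : TorusSmooth n) : (Fin n → ℝ) → ℂ) =
    (f : (Fin n → ℝ) → ℂ) + g := rfl

theorem coe_smul (a : ℂ) (f : TorusSmooth n) : ((a • f : TorusSmooth n) : (Fin n → ℝ) → ℂ) =
    a • (f : (Fin n → ℝ) → ℂ) := rfl

end TorusSmooth

theorem IsTorusPeriodic.iteratedFDeriv {n : ℕ} {f : (Fin n → ℝ) → ℂ} (hf : IsTorusPeriodic f)
    (k : ℕ) : IsTorusPeriodic (iteratedFDeriv ℝ k f) := by
  intro j y
  rw [← iteratedFDeriv_comp_add_right]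
  exact congrArg (fun g => _root_.iteratedFDeriv ℝ k g y) (funext (hf j))

theorem IsTorusPeriodic.add_int {n : ℕ} {F : Type*} {f : (Fin n → ℝ) → F}
    (hf : IsTorusPeriodic f) (η : Fin n → ℤ) (y : Fin n → ℝ) :
    f (y + fun j => η j * (2 * Real.pi)) = f y := by
  have one : ∀ (j : Fin n) (k : ℤ) (z : Fin n → ℝ),
      f (z + Pi.single j (k * (2 * Real.pi))) = f z := by
    intro j k z
    have hp : Function.Periodic (fun s : ℝ => f (z + Pi.single j s)) (2 * Real.pi) := by
      intro s
      simp only [Pi.single_add, ← add_assoc]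
      exact hf j _
    simpa using hp.int_mul k 0
  have key : ∀ s : Finset (Fin n), f (y + ∑ j ∈ s, Pi.single j (η j * (2 * Real.pi))) = f y := by
    intro s
    induction s using Finset.induction_on with
    | empty => simp
    | insert a s ha ih => rw [Finset.sum_insert ha, add_comm (Pi.single a _), ← add_assoc, one, ih]
  have h := key Finset.univ
  rwa [Finset.univ_sum_single] at h

theorem IsTorusPeriodic.bddAbove_norm {n : ℕ} {F : Type*} [NormedAddCommGroup F]
    {f : (Fin n → ℝ) → F} (hf : IsTorusPeriodic f) (hc : Continuous f) :
    BddAbove (Set.range fun y => ‖f y‖) := by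
  have hK : IsCompact (Set.Icc (0 : Fin n → ℝ) fun _ => 2 * Real.pi) := isCompact_Icc
  obtain ⟨C, hC⟩ := hK.exists_bound_of_continuousOn hc.continuousOn
  refine ⟨C, ?_⟩
  rintro _ ⟨y, rfl⟩
  have hpi : (0 : ℝ) < 2 * Real.pi := Real.two_pi_pos
  have h := hf.add_int (fun j => -⌊y j / (2 * Real.pi)⌋) y
  simp only
  rw [← h]
  apply hC
  constructor
  · intro j
    have := Int.floor_le (y j / (2 * Real.pi))
    rw [le_div_iff₀ hpi] at this
    simp only [Pi.zero_apply, Pi.add_apply, Int.cast_neg]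
    linarith
  · intro j
    have := (Int.lt_floor_add_one (y j / (2 * Real.pi))).le
    rw [div_le_iff₀ hpi] at this
    simp only [Pi.add_apply, Int.cast_neg]
    linarith

namespace TorusSmooth

variable {n : ℕ}

theorem bddAbove_iteratedFDeriv (f : TorusSmooth n) (k : ℕ) :
    BddAbove (Set.range fun y => ‖iteratedFDeriv ℝ k f y‖) :=
  (f.periodic.iteratedFDeriv k).bddAbove_norm
    (f.contDiff.continuous_iteratedFDeriv (by exact_mod_cast le_top))

/-- The seminorm `f ↦ sup_y ‖f^{(k)}(y)‖` on `C^∞(𝕋ⁿ)`. -/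
def seminorm (n : ℕ) (k : ℕ) : Seminorm ℂ (TorusSmooth n) :=
  Seminorm.of (fun f => ⨆ y, ‖iteratedFDeriv ℝ k f y‖)
    (fun f g => by
      refine ciSup_le fun y => ?_
      rw [coe_add, iteratedFDeriv_add_apply (f.contDiff.contDiffAt.of_le (by exact_mod_cast le_top))
        (g.contDiff.contDiffAt.of_le (by exact_mod_cast le_top))]
      exact (norm_add_le _ _).trans
        (add_le_add (le_ciSup (f.bddAbove_iteratedFDeriv k) y)
          (le_ciSup (g.bddAbove_iteratedFDeriv k) y)))
    (fun a f => by
      rw [Real.mul_iSup_of_nonneg (norm_nonneg a)]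
      refine iSup_congr fun y => ?_
      rw [coe_smul, iteratedFDeriv_const_smul_apply
        (f.contDiff.contDiffAt.of_le (by exact_mod_cast le_top)), norm_smul])

/-- The topology of `C^∞(𝕋ⁿ)`: uniform convergence of the derivatives of every order. -/
instance : TopologicalSpace (TorusSmooth n) :=
  SeminormFamily.moduleFilterBasis (seminorm n : SeminormFamily ℂ (TorusSmooth n) ℕ) |>.topology

theorem withSeminorms (n : ℕ) :
    WithSeminorms (seminorm n : SeminormFamily ℂ (TorusSmooth n) ℕ) := ⟨rfl⟩

instance : IsTopologicalAddGroup (TorusSmooth n) := (withSeminorms n).topologicalAddGroup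

instance : ContinuousSMul ℂ (TorusSmooth n) := (withSeminorms n).continuousSMul

end TorusSmooth

/-! Derivatives, discrete symbols, and the classes of pseudodifferential operators. -/

/-- `D_j f = -i ∂f/∂y_j`. -/
def partialD {n : ℕ} (j : Fin n) (f : (Fin n → ℝ) → ℂ) : (Fin n → ℝ) → ℂ :=
  fun y => -Complex.I * fderiv ℝ f y (Pi.single j 1)

/-- `D^α f = D_1^{α_1} ⋯ D_n^{α_n} f`. -/
def multiD {n : ℕ} (α : Fin n → ℕ) (f : (Fin n → ℝ) → ℂ) : (Fin n → ℝ) → ℂ :=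
  (List.finRange n).foldr (fun j g => (partialD j)^[α j] g) f

/-- The operator `D_j = -i ∂/∂y_j` on `C^∞(𝕋ⁿ)`. -/
def TorusSmooth.D {n : ℕ} (j : Fin n) : TorusSmooth n →ₗ[ℂ] TorusSmooth n where
  toFun f := TorusSmooth.mk (partialD j f)
    (contDiff_const.mul ((f.contDiff.fderiv_right (by simp)).clm_apply contDiff_const))
    (fun i y => by
      unfold partialD
      rw [← fderiv_comp_add_right]
      exact congrArg (fun g => -Complex.I * fderiv ℝ g y (Pi.single j 1))
        (funext (f.periodic i)))
  map_add' f g := by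
    ext y
    have hf : DifferentiableAt ℝ f y := f.contDiff.differentiable (by simp) y
    have hg : DifferentiableAt ℝ g y := g.contDiff.differentiable (by simp) y
    change partialD j ((f : (Fin n → ℝ) → ℂ) + g) y = partialD j f y + partialD j g y
    simp only [partialD, fderiv_add hf hg, _root_.add_apply, mul_add]
  map_smul' a f := by
    ext y
    have hf : DifferentiableAt ℝ f y := f.contDiff.differentiable (by simp) y
    change partialD j (a • (f : (Fin n → ℝ) → ℂ)) y = a * partialD j f y
    simp only [partialD, fderiv_const_smul hf a, _root_.smul_apply, smul_eq_mul]
    ring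

/-- The exponential `y ↦ e^{i y·η}` on `𝕋ⁿ`, for `η ∈ ℤⁿ`. -/
def torusExp {n : ℕ} (η : Fin n → ℤ) : TorusSmooth n :=
  TorusSmooth.mk (fun y => Complex.exp (Complex.I * ((∑ j, y j * (η j : ℝ) : ℝ) : ℂ)))
    (by
      have h : ContDiff ℝ ∞ fun y : Fin n → ℝ => ∑ j, y j * (η j : ℝ) :=
        ContDiff.sum fun j _ => (contDiff_apply ℝ ℝ j).mul contDiff_const
      exact Complex.contDiff_exp.comp
        (contDiff_const.mul (Complex.ofRealCLM.contDiff.comp h)))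
    (fun i y => by
      have h : ∑ j, (y + Pi.single i (2 * Real.pi) : Fin n → ℝ) j * (η j : ℝ)
          = ∑ j, y j * (η j : ℝ) + 2 * Real.pi * η i := by
        simp [add_mul, Finset.sum_add_distrib, Pi.single_apply]
      beta_reduce
      rw [h, Complex.exp_eq_exp_iff_exists_int]
      refine ⟨η i, ?_⟩
      push_cast
      ring)

/-- The Euclidean length `|ξ|` of `ξ ∈ ℤⁿ`. -/
def latticeNorm {n : ℕ} (ξ : Fin n → ℤ) : ℝ := Real.sqrt (∑ j, (ξ j : ℝ) ^ 2)

/-- The discrete symbol `Q(y, η) = e^{-i y·η} (Q e^{i y·η})(y)` of an operator on `C^∞(𝕋ⁿ)`. -/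
def discreteSymbol {n : ℕ} (Q : TorusSmooth n →L[ℂ] TorusSmooth n) (y : Fin n → ℝ)
    (η : Fin n → ℤ) : ℂ :=
  torusExp (-η) y * Q (torusExp η) y

/-- The class `S^m(𝕋ⁿ × ℤⁿ)` of pseudodifferential operators of order `m`: for every multi-index
`α` one has `|D_y^α Q(y, η)| ≤ C_α (1 + |η|)^m`. -/
def IsPseudodiffOfOrder {n : ℕ} (m : ℝ) (Q : TorusSmooth n →L[ℂ] TorusSmooth n) : Prop :=
  ∀ α : Fin n → ℕ, ∃ C : ℝ, 0 < C ∧ ∀ (y : Fin n → ℝ) (η : Fin n → ℤ),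
    ‖multiD α (fun z => discreteSymbol Q z η) y‖ ≤ C * (1 + latticeNorm η) ^ m

/-! Tube type operators `P = D_t + c(t, D_x)` on `𝕋^{N+1} = S¹ × 𝕋^N`. The variable `t` is the
coordinate with index `0`, and `x` consists of the other coordinates. -/

/-- The discrete symbol of `c` at `((t, x), (τ, ξ))` depends only on `(t, ξ)`. -/
def IsTubeType {N : ℕ} (c : TorusSmooth (N + 1) →L[ℂ] TorusSmooth (N + 1)) : Prop :=
  ∀ (t : ℝ) (x x' : Fin N → ℝ) (τ τ' : ℤ) (ξ : Fin N → ℤ),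
    discreteSymbol c (Fin.cons t x) (Fin.cons τ ξ) =
      discreteSymbol c (Fin.cons t x') (Fin.cons τ' ξ)

/-- The symbol `c(t, ξ)` of a tube type operator. -/
def tubeSymbol {N : ℕ} (c : TorusSmooth (N + 1) →L[ℂ] TorusSmooth (N + 1)) (t : ℝ)
    (ξ : Fin N → ℤ) : ℂ :=
  discreteSymbol c (Fin.cons t 0) (Fin.cons 0 ξ)

/-- The symbol `b(t, ξ)` of the imaginary part of `c(t, D_x)`. -/
def imSymbol {N : ℕ} (c : TorusSmooth (N + 1) →L[ℂ] TorusSmooth (N + 1)) (t : ℝ)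
    (ξ : Fin N → ℤ) : ℝ :=
  (tubeSymbol c t ξ).im

/-- The average `c_0(ξ) = (2π)⁻¹ ∫_0^{2π} c(t, ξ) dt`. -/
def symbolAverage {N : ℕ} (c : TorusSmooth (N + 1) →L[ℂ] TorusSmooth (N + 1))
    (ξ : Fin N → ℤ) : ℂ :=
  (2 * Real.pi : ℂ)⁻¹ * ∫ t in (0 : ℝ)..(2 * Real.pi), tubeSymbol c t ξ

/-- The set `𝒵` of all `ξ ∈ ℤ^N` with `c_0(ξ) ∈ ℤ`. -/
def integerAverageSet {N : ℕ} (c : TorusSmooth (N + 1) →L[ℂ] TorusSmooth (N + 1)) :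
    Set (Fin N → ℤ) :=
  {ξ | ∃ k : ℤ, symbolAverage c ξ = (k : ℂ)}

/-- The primitive `B(t, ξ) = ∫_0^t b(τ, ξ) dτ`. -/
def imPrimitive {N : ℕ} (c : TorusSmooth (N + 1) →L[ℂ] TorusSmooth (N + 1)) (t : ℝ)
    (ξ : Fin N → ℤ) : ℝ :=
  ∫ τ in (0 : ℝ)..t, imSymbol c τ ξ

/-- `c` is positively homogeneous of degree `m`: it is a pseudodifferential operator of order `m`
and its symbol satisfies `c(t, nξ) = n^m c(t, ξ)` for all positive integers `n`. -/
def IsPosHomogeneous {N : ℕ} (m : ℕ) (c : TorusSmooth (N + 1) →L[ℂ] TorusSmooth (N + 1)) : Prop :=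
  IsPseudodiffOfOrder (m : ℝ) c ∧
    ∀ (t : ℝ) (ξ : Fin N → ℤ) (n : ℕ), 0 < n →
      tubeSymbol c t (n • ξ) = (n : ℂ) ^ m * tubeSymbol c t ξ

/-- The operator `P = D_t + c(t, D_x)`. -/
def tubeOperator {N : ℕ} (c : TorusSmooth (N + 1) →L[ℂ] TorusSmooth (N + 1)) :
    TorusSmooth (N + 1) →ₗ[ℂ] TorusSmooth (N + 1) :=
  TorusSmooth.D 0 + (c : TorusSmooth (N + 1) →ₗ[ℂ] TorusSmooth (N + 1))

/-- An operator on `C^∞(𝕋ⁿ)` is globally solvable if its range is closed. -/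
def IsGloballySolvable {n : ℕ} (P : TorusSmooth n →ₗ[ℂ] TorusSmooth n) : Prop :=
  IsClosed (Set.range P)

/-- The condition `(α)_D^+` at `ξ`, for an operator of order `m`. The open interval is `(p, q)`. -/
def AlphaPlus {N : ℕ} (m : ℝ) (c : TorusSmooth (N + 1) →L[ℂ] TorusSmooth (N + 1)) (D : ℝ)
    (ξ : Fin N → ℤ) : Prop :=
  ∀ t ∈ Set.Icc 0 (2 * Real.pi), ∀ p q : ℝ, p < q →
    Set.Ioo p q ⊆ Set.Icc t (t + 2 * Real.pi) → latticeNorm ξ ^ (-m) ≤ q - p →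
      ∃ s ∈ Set.Ioo p q, imPrimitive c t ξ - imPrimitive c s ξ ≤ D * Real.log (latticeNorm ξ)

/-- The condition `(α)_D^-` at `ξ`, for an operator of order `m`. The open interval is `(p, q)`. -/
def AlphaMinus {N : ℕ} (m : ℝ) (c : TorusSmooth (N + 1) →L[ℂ] TorusSmooth (N + 1)) (D : ℝ)
    (ξ : Fin N → ℤ) : Prop :=
  ∀ t ∈ Set.Icc 0 (2 * Real.pi), ∀ p q : ℝ, p < q →
    Set.Ioo p q ⊆ Set.Icc (t - 2 * Real.pi) t → latticeNorm ξ ^ (-m) ≤ q - p →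
      ∃ s ∈ Set.Ioo p q, imPrimitive c t ξ - imPrimitive c s ξ ≤ D * Real.log (latticeNorm ξ)

end

/-! At the frequency `nξ₀` in `x`, the equation `P u = f` is the periodic ODE `D_t u + n^m c(t, ξ₀)
u = f`. Its homogeneous solutions are the multiples of `exp(n^m Φ)`, where `Φ(t) = -i ∫_s^t c(τ, ξ₀)
dτ` and `Re Φ(t) = ∫_s^t b(τ, ξ₀) dτ`. As `b(·, ξ₀)` changes sign, there are an interval `[p, q]`
shorter than a period and a point `s` in it where a primitive of `b` exceeds its values at `p` and
`q`. Cutting `exp(n^m Φ)` off near the ends of `[p, q]` gives `u_n` with coefficient `1` at `t = s`,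
while `P u_n` contains only the derivative of the cutoff and is `O(e^{-δ n^m})`, up to powers of
`n^m` for its derivatives (`exists_cutoff`, `exists_almost_null_modes`).

Hence `∑ P u_n`, over the `n` with `c_0(nξ₀) ∉ ℤ`, converges in `C^∞`, although `∑ u_n` does not. If
the range were closed, the sum would be `P v`. For these `n` the homogeneous ODE has no nonzero
periodic solution, so `v` has the same coefficient at `nξ₀` as `u_n`, namely `1` at `t = s`. There
are infinitely many such `n`, by a coprimality argument, and this contradicts the decay of the
Fourier coefficients of `v(s, ·)`.

The failure of both conditions `(α)` is local: to the right of a point with `b < 0`, or to the left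
of one with `b > 0`, the difference of `B` at a fixed distance grows like `n^m`, which beats `D log
|nξ₀|`.

The link between `P` and the ODEs is that Fourier series converge in `C^∞`, so that the continuous
operator `c` is determined by its values on exponentials (`hasSum_coef_smul_torusExp`). -/

noncomputable section

/-! ### Fourier coefficients of smooth functions on the torus -/

section

open MeasureTheory

attribute [local instance] instMeasureSpaceUnitAddCircle

attribute [local instance] instIsAddHaarMeasureUnitAddCircleVolume

attribute [local instance] instIsProbabilityMeasureUnitAddCircleVolume

/-- The projection `ℝⁿ → (ℝ / ℤ)ⁿ`. -/
def torusProj {n : ℕ} (x : Fin n → ℝ) : UnitAddTorus (Fin n) := fun j => (x j : UnitAddCircle)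

theorem isOpenQuotientMap_torusProj {n : ℕ} : IsOpenQuotientMap (torusProj (n := n)) :=
  IsOpenQuotientMap.piMap fun _ => QuotientAddGroup.isOpenQuotientMap_mk

namespace TorusSmooth

variable {n : ℕ}

theorem norm_apply_le (w : TorusSmooth n) (y : Fin n → ℝ) : ‖w y‖ ≤ seminorm n 0 w := by
  have h : ‖iteratedFDeriv ℝ 0 w y‖ ≤ seminorm n 0 w := le_ciSup (w.bddAbove_iteratedFDeriv 0) y
  rwa [norm_iteratedFDeriv_zero] at h

theorem norm_iteratedFDeriv_le (w : TorusSmooth n) (k : ℕ) (y : Fin n → ℝ) :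
    ‖iteratedFDeriv ℝ k w y‖ ≤ seminorm n k w :=
  le_ciSup (w.bddAbove_iteratedFDeriv k) y

theorem seminorm_le {w : TorusSmooth n} {k : ℕ} {C : ℝ}
    (h : ∀ y, ‖iteratedFDeriv ℝ k w y‖ ≤ C) : seminorm n k w ≤ C :=
  ciSup_le h

@[simp] theorem sub_apply (f g : TorusSmooth n) (y : Fin n → ℝ) : (f - g) y = f y - g y := rfl

/-- Two representatives of a point of `(ℝ / ℤ)ⁿ` differ by an integer vector, which the factor `2π`
turns into a period of `w`. -/
theorem apply_surjInv_torusProj (w : TorusSmooth n) (x : Fin n → ℝ) :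
    w (fun j => 2 * Real.pi *
      Function.surjInv isOpenQuotientMap_torusProj.surjective (torusProj x) j) =
      w (fun j => 2 * Real.pi * x j) := by
  have h1 : torusProj (Function.surjInv isOpenQuotientMap_torusProj.surjective (torusProj x)) =
      torusProj x := Function.surjInv_eq _ _
  have h2 : ∀ j, ∃ k : ℤ,
      Function.surjInv isOpenQuotientMap_torusProj.surjective (torusProj x) j = x j + k := by
    intro j
    have := congrFun h1 j
    simp only [torusProj] at this
    rw [QuotientAddGroup.eq_iff_sub_mem, AddSubgroup.mem_zmultiples_iff] at this
    obtain ⟨k, hk⟩ := this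
    refine ⟨k, ?_⟩
    simp at hk
    linarith
  choose k hk using h2
  rw [← w.periodic.add_int k fun j => 2 * Real.pi * x j]
  refine congrArg _ (funext fun j => ?_)
  simp only [hk, Pi.add_apply]
  ring

/-- A smooth periodic function as a continuous function on `(ℝ / ℤ)ⁿ`. -/
def lift (w : TorusSmooth n) : C(UnitAddTorus (Fin n), ℂ) where
  toFun z := w (fun j => 2 * Real.pi * Function.surjInv isOpenQuotientMap_torusProj.surjective z j)
  continuous_toFun := by
    rw [isOpenQuotientMap_torusProj.isQuotientMap.continuous_iff]
    change Continuous fun x => w _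
    simp_rw [apply_surjInv_torusProj]
    exact w.contDiff.continuous.comp (by fun_prop)

theorem lift_torusProj (w : TorusSmooth n) (x : Fin n → ℝ) :
    w.lift (torusProj x) = w (fun j => 2 * Real.pi * x j) :=
  apply_surjInv_torusProj w x

end TorusSmooth

theorem torusExp_apply {n : ℕ} (η : Fin n → ℤ) (y : Fin n → ℝ) :
    torusExp η y = Complex.exp (Complex.I * ((∑ j, y j * (η j : ℝ) : ℝ) : ℂ)) := rfl

theorem lift_torusExp {n : ℕ} (η : Fin n → ℤ) :
    (torusExp η).lift = UnitAddTorus.mFourier η := by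
  ext z
  obtain ⟨x, rfl⟩ := isOpenQuotientMap_torusProj.surjective z
  rw [TorusSmooth.lift_torusProj]
  simp only [torusExp_apply, UnitAddTorus.mFourier, ContinuousMap.coe_mk,
    torusProj, fourier_coe_apply, ← Complex.exp_sum]
  congr 1
  push_cast
  rw [Finset.mul_sum]
  refine Finset.sum_congr rfl fun j _ => ?_
  ring

namespace TorusSmooth

variable {n : ℕ}

/-- The Fourier coefficient of `w` at `η`. -/
def coef (η : Fin n → ℤ) (w : TorusSmooth n) : ℂ := UnitAddTorus.mFourierCoeff w.lift η

theorem coef_eq (η : Fin n → ℤ) (w : TorusSmooth n) :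
    coef η w = ∫ z, UnitAddTorus.mFourier (-η) z * w.lift z := rfl

theorem norm_mFourier_apply (η : Fin n → ℤ) (z : UnitAddTorus (Fin n)) :
    ‖UnitAddTorus.mFourier η z‖ ≤ 1 :=
  (ContinuousMap.norm_coe_le_norm _ z).trans UnitAddTorus.mFourier_norm.le

theorem integrable_continuousMap (f : C(UnitAddTorus (Fin n), ℂ)) : Integrable f :=
  f.continuous.integrable_of_hasCompactSupport
    (HasCompactSupport.of_compactSpace f)

theorem norm_coef_le (η : Fin n → ℤ) (w : TorusSmooth n) {C : ℝ} (h : ∀ y, ‖w y‖ ≤ C) :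
    ‖coef η w‖ ≤ C := by
  rw [coef_eq]
  have := norm_integral_le_of_norm_le_const (μ := (volume : Measure (UnitAddTorus (Fin n))))
    (f := fun z => UnitAddTorus.mFourier (-η) z * w.lift z) (C := C)
    (Filter.Eventually.of_forall fun z => by
      rw [norm_mul]
      have h1 := norm_mFourier_apply (-η) z
      have h2 : ‖w.lift z‖ ≤ C := h _
      calc _ ≤ 1 * ‖w.lift z‖ := by gcongr
        _ ≤ C := by rwa [one_mul])
  simpa using this

theorem coef_add (η : Fin n → ℤ) (v w : TorusSmooth n) :
    coef η (v + w) = coef η v + coef η w := by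
  simp only [coef_eq]
  have h : ∀ u : TorusSmooth n, Integrable fun z => UnitAddTorus.mFourier (-η) z * u.lift z :=
    fun u => integrable_continuousMap (UnitAddTorus.mFourier (-η) * u.lift)
  rw [← integral_add (h v) (h w)]
  refine integral_congr_ae (Filter.Eventually.of_forall fun z => ?_)
  change _ * (v.lift z + w.lift z) = _
  ring

theorem coef_smul (η : Fin n → ℤ) (a : ℂ) (w : TorusSmooth n) :
    coef η (a • w) = a * coef η w := by
  simp only [coef_eq]
  rw [← integral_const_mul]
  refine integral_congr_ae (Filter.Eventually.of_forall fun z => ?_)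
  change _ * (a * w.lift z) = _
  ring

theorem coef_torusExp_self (η : Fin n → ℤ) : coef η (torusExp η) = 1 := by
  rw [coef_eq, lift_torusExp]
  simp_rw [← UnitAddTorus.mFourier_add]
  simp [UnitAddTorus.mFourier_zero]

/-- Differentiation under the integral sign, dominated by the constant `C`. It serves both for
translates and for slices in `t`. -/
theorem hasDerivAt_coef (η : Fin n → ℤ) {G G' : ℝ → TorusSmooth n} {C : ℝ}
    (hG : ∀ y s, HasDerivAt (fun s => G s y) (G' s y) s) (hC : ∀ s y, ‖G' s y‖ ≤ C) (s : ℝ) :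
    HasDerivAt (fun s => coef η (G s)) (coef η (G' s)) s := by
  simp only [coef_eq]
  refine (hasDerivAt_integral_of_dominated_loc_of_deriv_le
    (F := fun s z => UnitAddTorus.mFourier (-η) z * (G s).lift z)
    (F' := fun s z => UnitAddTorus.mFourier (-η) z * (G' s).lift z) (bound := fun _ => C)
    Filter.univ_mem ?_ ?_ ?_ ?_ ?_ ?_).2
  · exact Filter.Eventually.of_forall fun s =>
      (integrable_continuousMap (UnitAddTorus.mFourier (-η) * (G s).lift)).aestronglyMeasurable
  · exact integrable_continuousMap (UnitAddTorus.mFourier (-η) * (G s).lift)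
  · exact (integrable_continuousMap
      (UnitAddTorus.mFourier (-η) * (G' s).lift)).aestronglyMeasurable
  · refine Filter.Eventually.of_forall fun z s _ => ?_
    rw [norm_mul]
    have h1 := norm_mFourier_apply (-η) z
    have h2 : ‖(G' s).lift z‖ ≤ C := hC s _
    calc _ ≤ 1 * ‖(G' s).lift z‖ := by gcongr
      _ ≤ C := by rwa [one_mul]
  · exact integrable_const _
  · exact Filter.Eventually.of_forall fun z s _ => (hG _ s).const_mul _

/-- The translate `y ↦ w (y + a)`. -/
def translate (a : Fin n → ℝ) (w : TorusSmooth n) : TorusSmooth n :=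
  mk (fun y => w (y + a)) (w.contDiff.comp (contDiff_id.add contDiff_const))
    (fun j y => by
      have := w.periodic j (y + a)
      rwa [add_right_comm] at this)

theorem translate_apply (a : Fin n → ℝ) (w : TorusSmooth n) (y : Fin n → ℝ) :
    translate a w y = w (y + a) := rfl

/-- Invariance of Haar measure, together with the fact that `mFourier` is a character. -/
theorem coef_translate (a : Fin n → ℝ) (η : Fin n → ℤ) (w : TorusSmooth n) :
    coef η (translate a w) =
      Complex.exp (Complex.I * ((∑ j, a j * (η j : ℝ) : ℝ) : ℂ)) * coef η w := by
  set b : Fin n → ℝ := fun j => a j / (2 * Real.pi) with hb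
  have hpi : (2 * Real.pi : ℝ) ≠ 0 := Real.two_pi_pos.ne'
  have h1 : ∀ z, (translate a w).lift z = w.lift (z + torusProj b) := by
    intro z
    obtain ⟨x, rfl⟩ := isOpenQuotientMap_torusProj.surjective z
    have : torusProj x + torusProj b = torusProj (x + b) := rfl
    rw [this, lift_torusProj, lift_torusProj, translate_apply]
    refine congrArg _ (funext fun j => ?_)
    simp only [hb, Pi.add_apply]
    field_simp
  have h2 : Complex.exp (Complex.I * ((∑ j, a j * (η j : ℝ) : ℝ) : ℂ)) =
      UnitAddTorus.mFourier η (torusProj b) := by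
    rw [← lift_torusExp, lift_torusProj]
    simp only [torusExp_apply, hb]
    congr 4
    ext j
    field_simp
  have h3 : ∀ z, UnitAddTorus.mFourier (-η) z = UnitAddTorus.mFourier η (torusProj b) *
      UnitAddTorus.mFourier (-η) (z + torusProj b) := by
    intro z
    have : UnitAddTorus.mFourier (-η) (z + torusProj b) =
        UnitAddTorus.mFourier (-η) z * UnitAddTorus.mFourier (-η) (torusProj b) := by
      simp only [UnitAddTorus.mFourier, ContinuousMap.coe_mk, ← Finset.prod_mul_distrib,
        Pi.add_apply, fourier_apply, smul_add, AddCircle.toCircle_add, Circle.coe_mul]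
    rw [this, mul_left_comm, ← UnitAddTorus.mFourier_add, add_neg_cancel,
      UnitAddTorus.mFourier_zero]
    simp
  rw [h2, coef_eq, coef_eq, ← integral_const_mul,
    ← integral_add_right_eq_self
      (fun z => UnitAddTorus.mFourier η (torusProj b) * (UnitAddTorus.mFourier (-η) z * w.lift z))
      (torusProj b)]
  refine integral_congr_ae (Filter.Eventually.of_forall fun z => ?_)
  simp only
  rw [h1, h3, mul_assoc]

/-- Instead of integrating by parts, the coefficient of the translate by `s e_j` is differentiated
at `s = 0` in two ways: under the integral, and through the factor `e^{i s η_j}`. -/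
theorem coef_D (η : Fin n → ℤ) (j : Fin n) (w : TorusSmooth n) :
    coef η (D j w) = η j * coef η w := by
  have hline : ∀ (y : Fin n → ℝ) (s : ℝ), HasDerivAt
      (fun s : ℝ => translate (Pi.single j s) w y)
      ((Complex.I • translate (Pi.single j s) (D j w)) y) s := by
    intro y s
    have h1 : HasFDerivAt w (fderiv ℝ w (y + Pi.single j s)) (y + Pi.single j s) :=
      (w.contDiff.differentiable (by simp) _).hasFDerivAt
    have h2 : HasDerivAt (fun s : ℝ => y + Pi.single j s) (Pi.single j 1) s :=
      (hasDerivAt_single j s).const_add y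
    have h3 := h1.comp_hasDerivAt s h2
    have h4 : (Complex.I • translate (Pi.single j s) (D j w)) y =
        fderiv ℝ w (y + Pi.single j s) (Pi.single j 1) := by
      change Complex.I * (-Complex.I * _) = _
      rw [← mul_assoc]
      simp
    rw [h4]
    exact h3
  have h1 := hasDerivAt_coef η hline (C := seminorm n 0 (D j w)) (by
    intro s y
    have := norm_apply_le (D j w) (y + Pi.single j s)
    rwa [smul_apply, norm_mul, Complex.norm_I, one_mul, translate_apply]) 0
  have h2 : HasDerivAt (fun s : ℝ => coef η (translate (Pi.single j s) w))
      (Complex.I * η j * coef η w) 0 := by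
    simp_rw [coef_translate]
    have : ∀ s : ℝ, ∑ i, (Pi.single j s : Fin n → ℝ) i * (η i : ℝ) = s * η j := by
      intro s
      simp [Pi.single_apply]
    simp_rw [this]
    refine HasDerivAt.mul_const ?_ _
    have h : HasDerivAt (fun s : ℝ => Complex.I * ((s * (η j : ℝ) : ℝ) : ℂ))
        (Complex.I * ((1 * (η j : ℝ) : ℝ) : ℂ)) 0 :=
      (((hasDerivAt_id (0 : ℝ)).mul_const (η j : ℝ)).ofReal_comp).const_mul _
    have := h.cexp
    simpa using this
  have h3 := h1.unique h2
  have h4 : translate (Pi.single j 0) (D j w) = D j w := by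
    ext y
    simp [translate]
  rw [h4, coef_smul, mul_assoc] at h3
  exact mul_left_cancel₀ Complex.I_ne_zero h3

end TorusSmooth
end

/-! ### Convergence of Fourier series in `C^∞` -/

section

theorem norm_iteratedFDeriv_real_cexp (k : ℕ) (z : ℂ) :
    ‖iteratedFDeriv ℝ k Complex.exp z‖ ≤ Real.exp z.re := by
  have h : ContDiffAt ℂ k Complex.exp z := Complex.contDiff_exp.contDiffAt
  rw [← h.restrictScalars_iteratedFDeriv (𝕜 := ℝ)]
  have h1 : ‖iteratedFDeriv ℂ k Complex.exp z‖ = Real.exp z.re := by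
    rw [norm_iteratedFDeriv_eq_norm_iteratedDeriv, iteratedDeriv_eq_iterate,
      Complex.iter_deriv_exp, Complex.norm_exp]
  rw [← h1]
  exact (ContinuousMultilinearMap.norm_restrictScalars _).le

/-- The Faà di Bruno bound: every derivative of `exp` at `f x` has norm at most `e^{Re f(x)}`, so
the size of the exponential survives differentiation. -/
theorem norm_iteratedFDeriv_cexp_comp_le {E : Type*} [NormedAddCommGroup E] [NormedSpace ℝ E]
    {f : E → ℂ} (hf : ContDiff ℝ ∞ f) (k : ℕ) (x : E) {D : ℝ}
    (hD : ∀ i, 1 ≤ i → i ≤ k → ‖iteratedFDeriv ℝ i f x‖ ≤ D ^ i) :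
    ‖iteratedFDeriv ℝ k (fun y => Complex.exp (f y)) x‖ ≤
      k.factorial * Real.exp (f x).re * D ^ k :=
  norm_iteratedFDeriv_comp_le (g := Complex.exp) (N := ∞) Complex.contDiff_exp hf
    (by exact_mod_cast le_top) x (fun i _ => norm_iteratedFDeriv_real_cexp i _) hD

theorem ContinuousLinearMap.norm_iteratedFDeriv_succ_le {E F : Type*} [NormedAddCommGroup E]
    [NormedSpace ℝ E] [NormedAddCommGroup F] [NormedSpace ℝ F] (L : E →L[ℝ] F) (k : ℕ) (x : E) :
    ‖iteratedFDeriv ℝ (k + 1) L x‖ ≤ ‖L‖ := by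
  rw [← norm_iteratedFDeriv_fderiv]
  have : fderiv ℝ L = fun _ => L := by
    ext1 y
    exact L.fderiv
  rw [this]
  rcases Nat.eq_zero_or_pos k with rfl | hk
  · simp
  · rw [iteratedFDeriv_const_of_ne hk.ne']
    simp

/-- The linear form `y ↦ i y·η`. -/
def torusPhase {n : ℕ} (η : Fin n → ℤ) : (Fin n → ℝ) →L[ℝ] ℂ :=
  ∑ j, (Complex.I * (η j : ℂ)) • (Complex.ofRealCLM.comp (ContinuousLinearMap.proj j))

theorem torusPhase_apply {n : ℕ} (η : Fin n → ℤ) (y : Fin n → ℝ) :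
    torusPhase η y = Complex.I * ((∑ j, y j * (η j : ℝ) : ℝ) : ℂ) := by
  simp only [torusPhase, sum_apply, Complex.ofReal_sum, Finset.mul_sum]
  refine Finset.sum_congr rfl fun j _ => ?_
  simp
  ring

theorem norm_torusPhase_le {n : ℕ} (η : Fin n → ℤ) : ‖torusPhase η‖ ≤ ∑ j, |(η j : ℝ)| := by
  refine ContinuousLinearMap.opNorm_le_bound _ (Finset.sum_nonneg fun _ _ => abs_nonneg _)
    fun y => ?_
  rw [torusPhase_apply, norm_mul, Complex.norm_I, one_mul, Complex.norm_real, Finset.sum_mul]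
  refine (norm_sum_le _ _).trans (Finset.sum_le_sum fun j _ => ?_)
  rw [norm_mul, mul_comm]
  exact mul_le_mul_of_nonneg_left (norm_le_pi_norm y j) (abs_nonneg _)

/-- The weight `∏ (1 + η_j²)` on `ℤⁿ`. -/
def latticeWeight {n : ℕ} (η : Fin n → ℤ) : ℝ := ∏ j, (1 + (η j : ℝ) ^ 2)

theorem one_le_latticeWeight {n : ℕ} (η : Fin n → ℤ) : 1 ≤ latticeWeight η :=
  Finset.one_le_prod fun j _ => by nlinarith [sq_nonneg (η j : ℝ)]

theorem sum_abs_le_latticeWeight {n : ℕ} (η : Fin n → ℤ) :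
    ∑ j, |(η j : ℝ)| ≤ latticeWeight η := by
  have h : ∀ s : Finset (Fin n), 1 + ∑ j ∈ s, (η j : ℝ) ^ 2 ≤ ∏ j ∈ s, (1 + (η j : ℝ) ^ 2) := by
    intro s
    induction s using Finset.induction_on with
    | empty => simp
    | insert a s ha ih =>
      rw [Finset.sum_insert ha, Finset.prod_insert ha]
      have h0 : 0 ≤ ∑ j ∈ s, (η j : ℝ) ^ 2 := Finset.sum_nonneg fun _ _ => sq_nonneg _
      nlinarith [mul_le_mul_of_nonneg_left ih (by positivity : 0 ≤ 1 + (η a : ℝ) ^ 2),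
        mul_nonneg (sq_nonneg (η a : ℝ)) h0]
  have h1 : ∀ j, |(η j : ℝ)| ≤ (η j : ℝ) ^ 2 := by
    intro j
    have : |η j| ≤ η j ^ 2 := by
      rw [← sq_abs]
      exact Int.le_self_sq _
    exact_mod_cast this
  calc _ ≤ ∑ j, (η j : ℝ) ^ 2 := Finset.sum_le_sum fun j _ => h1 j
    _ ≤ 1 + ∑ j, (η j : ℝ) ^ 2 := by linarith
    _ ≤ _ := h _

theorem summable_inv_latticeWeight (n : ℕ) :
    Summable fun η : Fin n → ℤ => (latticeWeight η)⁻¹ := by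
  induction n with
  | zero => exact Summable.of_finite
  | succ n ih =>
    have h1 : Summable fun k : ℤ => (1 + (k : ℝ) ^ 2)⁻¹ := by
      have h2 : Summable fun k : ℤ => 1 / (k : ℝ) ^ 2 :=
        Real.summable_one_div_int_pow.mpr one_lt_two
      refine Summable.of_norm_bounded_eventually h2 ?_
      have : ({0}ᶜ : Set ℤ) ∈ Filter.cofinite := (Set.finite_singleton 0).compl_mem_cofinite
      filter_upwards [this] with k hk
      have hk' : (k : ℝ) ≠ 0 := by exact_mod_cast hk
      have : 0 < (k : ℝ) ^ 2 := by positivity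
      rw [Real.norm_of_nonneg (by positivity), one_div]
      exact inv_anti₀ this (by linarith)
    have h2 := h1.mul_of_nonneg ih (fun _ => by positivity)
      (fun η => inv_nonneg.mpr (zero_le_one.trans (one_le_latticeWeight η)))
    rw [← (Fin.consEquiv fun _ => ℤ).summable_iff]
    convert! h2 using 2 with p
    simp only [Function.comp_apply, latticeWeight, Fin.consEquiv, Equiv.coe_fn_mk,
      Fin.prod_univ_succ, Fin.cons_zero, Fin.cons_succ, mul_inv]

namespace TorusSmooth

variable {n : ℕ}

theorem seminorm_torusExp_le (η : Fin n → ℤ) (k : ℕ) :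
    seminorm n k (torusExp η) ≤ k.factorial * latticeWeight η ^ k := by
  refine seminorm_le fun y => ?_
  have h := norm_iteratedFDeriv_cexp_comp_le (torusPhase η).contDiff k y
    (D := latticeWeight η) (by
      intro i h1 _
      obtain ⟨i, rfl⟩ := Nat.exists_eq_add_of_le' h1
      refine ((torusPhase η).norm_iteratedFDeriv_succ_le i y).trans ?_
      refine ((norm_torusPhase_le η).trans (sum_abs_le_latticeWeight η)).trans ?_
      exact le_self_pow₀ (one_le_latticeWeight η) (by simp))
  have h2 : (torusPhase η y).re = 0 := by
    rw [torusPhase_apply]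
    simp
  rw [h2, Real.exp_zero, mul_one] at h
  have h3 : (fun y => Complex.exp (torusPhase η y)) = torusExp η := by
    ext y
    rw [torusPhase_apply]
    rfl
  rwa [h3] at h

/-- The weight is the Fourier multiplier of `∏ (1 + D_j²)`, applied one variable at a time. -/
theorem exists_coef_eq_latticeWeight_mul (w : TorusSmooth n) :
    ∃ w' : TorusSmooth n, ∀ η, coef η w' = latticeWeight η * coef η w := by
  have h : ∀ s : Finset (Fin n), ∃ w' : TorusSmooth n, ∀ η,
      coef η w' = (∏ j ∈ s, (1 + (η j : ℝ) ^ 2) : ℝ) * coef η w := by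
    intro s
    induction s using Finset.induction_on with
    | empty => exact ⟨w, fun η => by simp⟩
    | insert a s ha ih =>
      obtain ⟨v, hv⟩ := ih
      refine ⟨v + D a (D a v), fun η => ?_⟩
      rw [coef_add, coef_D, coef_D, hv, Finset.prod_insert ha]
      push_cast
      ring
  exact h Finset.univ

theorem exists_norm_coef_le (w : TorusSmooth n) (K : ℕ) :
    ∃ C, 0 ≤ C ∧ ∀ η, ‖coef η w‖ ≤ C * (latticeWeight η ^ K)⁻¹ := by
  have h : ∃ w' : TorusSmooth n, ∀ η, coef η w' = (latticeWeight η ^ K : ℝ) * coef η w := by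
    induction K with
    | zero => exact ⟨w, fun η => by simp⟩
    | succ K ih =>
      obtain ⟨v, hv⟩ := ih
      obtain ⟨v', hv'⟩ := exists_coef_eq_latticeWeight_mul v
      refine ⟨v', fun η => ?_⟩
      rw [hv', hv]
      push_cast
      ring
  obtain ⟨v, hv⟩ := h
  refine ⟨seminorm n 0 v, apply_nonneg _ _, fun η => ?_⟩
  have h1 := norm_coef_le η v (norm_apply_le v)
  have h2 : 0 < latticeWeight η ^ K := pow_pos (one_pos.trans_le (one_le_latticeWeight η)) _
  rw [hv, norm_mul, Complex.norm_real, Real.norm_of_nonneg h2.le] at h1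
  rw [← div_eq_mul_inv, le_div_iff₀ h2]
  linarith

theorem summable_norm_coef (w : TorusSmooth n) : Summable fun η => ‖coef η w‖ := by
  obtain ⟨C, _, hC⟩ := exists_norm_coef_le w 1
  refine Summable.of_nonneg_of_le (fun _ => norm_nonneg _) hC ?_
  simpa using (summable_inv_latticeWeight n).mul_left C

/-- A linear functional bounded by the sup norm, as a continuous linear functional. -/
def mkCLM (ℓ : TorusSmooth n →ₗ[ℂ] ℂ) (h : ∀ w, ‖ℓ w‖ ≤ seminorm n 0 w) :
    TorusSmooth n →L[ℂ] ℂ :=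
  ⟨ℓ, WithSeminorms.continuous_normedSpace_rng ℂ (withSeminorms n) ℓ
    ⟨{0}, 1, fun w => by simpa using h w⟩⟩

/-- Evaluation at `y`. -/
def evalCLM (y : Fin n → ℝ) : TorusSmooth n →L[ℂ] ℂ :=
  mkCLM { toFun := fun w => w y, map_add' := fun _ _ => rfl, map_smul' := fun _ _ => rfl }
    (fun w => norm_apply_le w y)

theorem evalCLM_apply (y : Fin n → ℝ) (w : TorusSmooth n) : evalCLM y w = w y := rfl

/-- The Weierstrass test in every seminorm: the derivatives of a tail are bounded by the tail of `v
k`. It is used for Fourier series and for the series of the `P u_n`. -/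
theorem exists_hasSum {ι : Type*} {g : ι → TorusSmooth n} {v : ℕ → ι → ℝ}
    (hv : ∀ k, Summable (v k)) (hg : ∀ k i, seminorm n k (g i) ≤ v k i) :
    ∃ G : TorusSmooth n, HasSum g G ∧ ∀ y, HasSum (fun i => g i y) (G y) := by
  have hs : ∀ y, Summable fun i => g i y := fun y =>
    Summable.of_norm_bounded (hv 0) fun i => (norm_apply_le (g i) y).trans (hg 0 i)
  have hd : ∀ k i y, ‖iteratedFDeriv ℝ k (g i) y‖ ≤ v k i := fun k i y =>
    (norm_iteratedFDeriv_le _ _ _).trans (hg k i)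
  let G : TorusSmooth n := mk (fun y => ∑' i, g i y)
    (contDiff_tsum (fun i => (g i).contDiff) (fun k _ => hv k) fun k i y _ => hd k i y)
    (fun j y => tsum_congr fun i => (g i).periodic j y)
  refine ⟨G, ?_, fun y => (hs y).hasSum⟩
  refine ((withSeminorms n).tendsto_nhds _ _).mpr fun k ε hε => ?_
  have h0 := tendsto_tsum_compl_atTop_zero (v k)
  filter_upwards [h0.eventually (gt_mem_nhds hε)] with s hs'
  rw [map_sub_rev]
  refine (seminorm_le fun y => ?_).trans_lt hs'
  have h1 : ((G - ∑ i ∈ s, g i : TorusSmooth n) : (Fin n → ℝ) → ℂ) =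
      fun y => ∑' i : {i // i ∉ s}, g i y := by
    ext y
    have h2 : (∑ i ∈ s, g i) y = ∑ i ∈ s, g i y := map_sum (evalCLM y) g s
    rw [sub_apply, h2]
    exact sub_eq_of_eq_add' ((hs y).sum_add_tsum_subtype_compl s).symm
  rw [h1, iteratedFDeriv_tsum_apply (N := ⊤) (v := fun k (i : {i // i ∉ s}) => v k i)
    (fun i => (g i).contDiff) (fun k _ => (hv k).subtype _)
    (fun k i y _ => hd k i y) (by exact_mod_cast le_top)]
  exact tsum_of_norm_bounded ((hv k).subtype {i | i ∉ s}).hasSum fun i => hd k i y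

/-- A smooth function on the torus is the sum of its Fourier series, in `C^∞`. -/
theorem hasSum_coef_smul_torusExp (w : TorusSmooth n) :
    HasSum (fun η => coef η w • torusExp η) w := by
  have hb : ∀ k, ∃ C : ℝ, ∀ η, seminorm n k (coef η w • torusExp η) ≤
      C * (latticeWeight η)⁻¹ := by
    intro k
    obtain ⟨C, hC0, hC⟩ := exists_norm_coef_le w (k + 1)
    refine ⟨C * k.factorial, fun η => ?_⟩
    rw [map_smul_eq_mul]
    have h0 : 0 < latticeWeight η := one_pos.trans_le (one_le_latticeWeight η)
    calc _ ≤ (C * (latticeWeight η ^ (k + 1))⁻¹) * (k.factorial * latticeWeight η ^ k) :=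
          mul_le_mul (hC η) (seminorm_torusExp_le η k) (apply_nonneg _ _) (by positivity)
      _ = _ := by
        field_simp
        ring
  choose C hC using hb
  obtain ⟨G, hG, hG'⟩ := exists_hasSum (g := fun η => coef η w • torusExp η)
    (v := fun k η => C k * (latticeWeight η)⁻¹)
    (fun k => (summable_inv_latticeWeight n).mul_left (C k)) hC
  -- The series converges in `C^∞` to some `G`; pointwise Fourier inversion for summable
  -- coefficients identifies `G` with `w`.
  suffices h : G = w by rwa [h] at hG
  ext y
  refine (hG' y).unique ?_
  have h1 := UnitAddTorus.hasSum_mFourier_series_apply_of_summable (f := w.lift)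
    (summable_norm_coef w).of_norm (torusProj fun j => y j / (2 * Real.pi))
  simp only [← lift_torusExp, lift_torusProj] at h1
  have h2 : (fun j => 2 * Real.pi * (y j / (2 * Real.pi))) = y := by
    ext j
    have := Real.pi_ne_zero
    field_simp
  rw [h2] at h1
  exact h1

end TorusSmooth
end

/-! ### Partial Fourier coefficients in `x` and the action of tube type operators -/

section

theorem torusExp_add_apply {n : ℕ} (η : Fin n → ℤ) (y z : Fin n → ℝ) :
    torusExp η (y + z) = torusExp η z * torusExp η y := by
  simp only [torusExp_apply, ← Complex.exp_add, Pi.add_apply, add_mul, Finset.sum_add_distrib]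
  push_cast
  ring_nf

theorem torusExp_mul_neg {n : ℕ} (η : Fin n → ℤ) (y : Fin n → ℝ) :
    torusExp η y * torusExp (-η) y = 1 := by
  simp only [torusExp_apply, ← Complex.exp_add]
  simp

theorem torusExp_single {n : ℕ} (η : Fin n → ℤ) (j : Fin n) (s : ℝ) :
    torusExp η (Pi.single j s) = Complex.exp (Complex.I * (s * (η j : ℝ) : ℝ)) := by
  rw [torusExp_apply]
  simp [Pi.single_apply]

namespace TorusSmooth

variable {n N : ℕ}

/-- The shift `s = π / (η_j - k)` multiplies the coefficient by `e^{isk}` according to the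
hypothesis and by `e^{isη_j} = -e^{isk}` according to `coef_translate`. -/
theorem coef_eq_zero_of_translate {w : TorusSmooth n} {j : Fin n} {k : ℤ}
    (h : ∀ s y, w (y + Pi.single j s) = Complex.exp (Complex.I * (s * (k : ℝ) : ℝ)) * w y)
    {η : Fin n → ℤ} (hη : η j ≠ k) : coef η w = 0 := by
  set s : ℝ := Real.pi / (η j - k) with hs
  have h1 : translate (Pi.single j s) w = Complex.exp (Complex.I * (s * (k : ℝ) : ℝ)) • w := by
    ext y
    exact h s y
  have h2 := coef_translate (Pi.single j s) η w
  have h3 : ∑ i, (Pi.single j s : Fin n → ℝ) i * (η i : ℝ) = s * k + Real.pi := by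
    have h4 : (η j : ℝ) - k ≠ 0 := sub_ne_zero.mpr (by exact_mod_cast hη)
    have h5 : ∑ i, (Pi.single j s : Fin n → ℝ) i * (η i : ℝ) = s * η j := by
      simp [Pi.single_apply]
    rw [h5, hs]
    field_simp
    ring
  rw [h1, coef_smul, h3, Complex.ofReal_add, mul_add, Complex.exp_add, mul_comm Complex.I
    (Real.pi : ℂ), Complex.exp_pi_mul_I] at h2
  have h6 := Complex.exp_ne_zero (Complex.I * (s * (k : ℝ) : ℝ))
  have h7 : Complex.exp (Complex.I * (s * (k : ℝ) : ℝ)) * (2 * coef η w) = 0 := by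
    linear_combination h2
  simpa [h6] using h7

theorem coef_torusExp_of_ne {η ξ : Fin n → ℤ} (h : η ≠ ξ) : coef ξ (torusExp η) = 0 := by
  obtain ⟨j, hj⟩ := Function.ne_iff.mp h
  refine coef_eq_zero_of_translate (j := j) (k := η j) (fun s y => ?_) hj.symm
  rw [torusExp_add_apply, torusExp_single]

/-- The restriction of `w` to the slice `{t} × 𝕋^N`. -/
def slice (t : ℝ) (w : TorusSmooth (N + 1)) : TorusSmooth N :=
  mk (fun x => w (Fin.cons t x))
    (w.contDiff.comp (contDiff_pi.mpr fun i => by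
      refine Fin.cases ?_ (fun j => ?_) i
      · exact contDiff_const
      · exact contDiff_apply ℝ ℝ j))
    (fun j x => by
      have h := w.periodic j.succ (Fin.cons t x)
      have h2 : (Fin.cons t (x + Pi.single j (2 * Real.pi)) : Fin (N + 1) → ℝ) =
          Fin.cons t x + Pi.single j.succ (2 * Real.pi) := by
        ext i
        refine Fin.cases ?_ (fun i => ?_) i
        · simp
        · simp [Pi.single_apply]
      rw [← h2] at h
      exact h)

theorem slice_apply (t : ℝ) (w : TorusSmooth (N + 1)) (x : Fin N → ℝ) :
    slice t w x = w (Fin.cons t x) := rfl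

/-- The Fourier coefficient at `ξ` in the variables `x`, as a function of `t`. -/
def partialCoef (t : ℝ) (ξ : Fin N → ℤ) : TorusSmooth (N + 1) →L[ℂ] ℂ :=
  mkCLM { toFun := fun w => coef ξ (slice t w)
          map_add' := fun v w => coef_add ξ (slice t v) (slice t w)
          map_smul' := fun a w => coef_smul ξ a (slice t w) }
    (fun w => norm_coef_le ξ (slice t w) fun x => norm_apply_le w (Fin.cons t x))

theorem partialCoef_apply (t : ℝ) (ξ : Fin N → ℤ) (w : TorusSmooth (N + 1)) :
    partialCoef t ξ w = coef ξ (slice t w) := rfl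

theorem partialCoef_add_two_pi (t : ℝ) (ξ : Fin N → ℤ) (w : TorusSmooth (N + 1)) :
    partialCoef (t + 2 * Real.pi) ξ w = partialCoef t ξ w := by
  rw [partialCoef_apply, partialCoef_apply]
  congr 1
  ext x
  rw [slice_apply, slice_apply, ← w.periodic 0 (Fin.cons t x)]
  refine congrArg _ (funext fun i => ?_)
  refine Fin.cases ?_ (fun i => ?_) i <;> simp

theorem hasDerivAt_partialCoef (t : ℝ) (ξ : Fin N → ℤ) (w : TorusSmooth (N + 1)) :
    HasDerivAt (fun t => partialCoef t ξ w) (Complex.I * partialCoef t ξ (D 0 w)) t := by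
  have hline : ∀ (x : Fin N → ℝ) (s : ℝ), HasDerivAt (fun s : ℝ => slice s w x)
      ((Complex.I • slice s (D 0 w)) x) s := by
    intro x s
    have h1 : HasFDerivAt w (fderiv ℝ w (Fin.cons s x)) (Fin.cons s x) :=
      (w.contDiff.differentiable (by simp) _).hasFDerivAt
    have h2 : HasDerivAt (fun s : ℝ => (Fin.cons s x : Fin (N + 1) → ℝ)) (Pi.single 0 1) s := by
      rw [hasDerivAt_pi]
      intro i
      refine Fin.cases ?_ (fun i => ?_) i
      · simpa using hasDerivAt_id' s
      · simpa using hasDerivAt_const s (x i)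
    have h3 := h1.comp_hasDerivAt s h2
    have h4 : (Complex.I • slice s (D 0 w)) x = fderiv ℝ w (Fin.cons s x) (Pi.single 0 1) := by
      change Complex.I * (-Complex.I * _) = _
      rw [← mul_assoc]
      simp
    rw [h4]
    exact h3
  have h1 := hasDerivAt_coef ξ hline (C := seminorm (N + 1) 0 (D 0 w)) (by
    intro s y
    have := norm_apply_le (D 0 w) (Fin.cons s y)
    rwa [smul_apply, norm_mul, Complex.norm_I, one_mul, slice_apply]) t
  rwa [coef_smul] at h1

end TorusSmooth

open TorusSmooth

variable {N : ℕ} {c : TorusSmooth (N + 1) →L[ℂ] TorusSmooth (N + 1)}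

theorem IsTubeType.apply_torusExp (hc : IsTubeType c) (η : Fin (N + 1) → ℤ)
    (y : Fin (N + 1) → ℝ) :
    c (torusExp η) y = tubeSymbol c (y 0) (Fin.tail η) * torusExp η y := by
  have h := hc (y 0) (Fin.tail y) 0 (η 0) 0 (Fin.tail η)
  rw [Fin.cons_self_tail, Fin.cons_self_tail] at h
  rw [tubeSymbol, ← h, discreteSymbol]
  linear_combination (-c (torusExp η) y) * torusExp_mul_neg η y

theorem hasSum_coef_mul_apply_torusExp (c : TorusSmooth (N + 1) →L[ℂ] TorusSmooth (N + 1))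
    (ℓ : TorusSmooth (N + 1) →L[ℂ] ℂ) (w : TorusSmooth (N + 1)) :
    HasSum (fun η => coef η w * ℓ (c (torusExp η))) (ℓ (c w)) := by
  have h := (ℓ.comp c).hasSum (hasSum_coef_smul_torusExp w)
  simpa using h

/-- By continuity it is enough to compare the terms of the Fourier series of `w`. On an exponential
both sides vanish unless its `x`-frequency is `ξ`, and then `c` multiplies by the symbol at `ξ`. -/
theorem IsTubeType.partialCoef_apply (hc : IsTubeType c) (t : ℝ) (ξ : Fin N → ℤ)
    (w : TorusSmooth (N + 1)) :
    partialCoef t ξ (c w) = tubeSymbol c t ξ * partialCoef t ξ w := by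
  have h1 := hasSum_coef_mul_apply_torusExp c (partialCoef t ξ) w
  have h2 := (hasSum_coef_mul_apply_torusExp (.id ℂ _) (partialCoef t ξ) w).mul_left
    (tubeSymbol c t ξ)
  refine h1.unique ?_
  convert! h2 using 2 with η
  have h3 : slice t (c (torusExp η)) =
      tubeSymbol c t (Fin.tail η) • slice t (torusExp η) := by
    ext x
    rw [smul_apply, slice_apply, slice_apply, hc.apply_torusExp, Fin.cons_zero]
  have h4 : slice t (torusExp η) =
      Complex.exp (Complex.I * ((t * (η 0 : ℝ) : ℝ) : ℂ)) • torusExp (Fin.tail η) := by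
    ext x
    rw [smul_apply, slice_apply, torusExp_apply, torusExp_apply, ← Complex.exp_add,
      Fin.sum_univ_succ]
    congr 1
    simp only [Fin.cons_zero, Fin.cons_succ, Fin.tail]
    push_cast
    ring
  rw [ContinuousLinearMap.id_apply, TorusSmooth.partialCoef_apply, TorusSmooth.partialCoef_apply,
    h3, h4, coef_smul, coef_smul]
  by_cases h : Fin.tail η = ξ
  · rw [h]
    ring
  · rw [coef_torusExp_of_ne h]
    ring

/-- The hypothesis says that `w` has the form `g(t) e^{i x·ξ}`. All its frequencies then have
`x`-part `ξ`, and on those `c` acts by one and the same factor. -/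
theorem IsTubeType.apply_of_translate (hc : IsTubeType c) {ξ : Fin N → ℤ}
    {w : TorusSmooth (N + 1)}
    (hw : ∀ (j : Fin N) (s : ℝ) (y : Fin (N + 1) → ℝ),
      w (y + Pi.single j.succ s) = Complex.exp (Complex.I * (s * (ξ j : ℝ) : ℝ)) * w y)
    (y : Fin (N + 1) → ℝ) : c w y = tubeSymbol c (y 0) ξ * w y := by
  have h1 := hasSum_coef_mul_apply_torusExp c (evalCLM y) w
  have h2 := (hasSum_coef_mul_apply_torusExp (.id ℂ _) (evalCLM y) w).mul_left
    (tubeSymbol c (y 0) ξ)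
  refine h1.unique ?_
  convert! h2 using 2 with η
  rw [ContinuousLinearMap.id_apply, evalCLM_apply, evalCLM_apply, hc.apply_torusExp]
  by_cases h : Fin.tail η = ξ
  · rw [h]
    ring
  · obtain ⟨j, hj⟩ := Function.ne_iff.mp h
    rw [coef_eq_zero_of_translate (hw j) hj]
    ring

theorem contDiff_tubeSymbol (c : TorusSmooth (N + 1) →L[ℂ] TorusSmooth (N + 1))
    (ξ : Fin N → ℤ) : ContDiff ℝ ∞ fun t => tubeSymbol c t ξ := by
  have h : ContDiff ℝ ∞ fun t : ℝ => (Fin.cons t (0 : Fin N → ℝ) : Fin (N + 1) → ℝ) := by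
    refine contDiff_pi.mpr fun i => ?_
    refine Fin.cases ?_ (fun j => ?_) i
    · exact contDiff_id
    · exact contDiff_const
  have h1 := (torusExp (-Fin.cons 0 ξ)).contDiff.comp h
  have h2 := (c (torusExp (Fin.cons 0 ξ))).contDiff.comp h
  exact h1.mul h2

theorem tubeSymbol_periodic (c : TorusSmooth (N + 1) →L[ℂ] TorusSmooth (N + 1))
    (ξ : Fin N → ℤ) : Function.Periodic (fun t => tubeSymbol c t ξ) (2 * Real.pi) := by
  intro t
  have h : (Fin.cons (t + 2 * Real.pi) (0 : Fin N → ℝ) : Fin (N + 1) → ℝ) =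
      Fin.cons t 0 + Pi.single 0 (2 * Real.pi) := by
    ext i
    refine Fin.cases ?_ (fun i => ?_) i <;> simp
  simp only [tubeSymbol, discreteSymbol, h]
  exact congrArg₂ _ ((torusExp _).periodic 0 _) ((c (torusExp _)).periodic 0 _)

theorem IsTubeType.hasDerivAt_partialCoef (hc : IsTubeType c) (t : ℝ) (ξ : Fin N → ℤ)
    (w : TorusSmooth (N + 1)) :
    HasDerivAt (fun t => partialCoef t ξ w)
      (Complex.I * (partialCoef t ξ (tubeOperator c w) - tubeSymbol c t ξ * partialCoef t ξ w))
      t := by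
  have h := TorusSmooth.hasDerivAt_partialCoef t ξ w
  have h2 : partialCoef t ξ (tubeOperator c w) =
      partialCoef t ξ (D 0 w) + partialCoef t ξ (c w) := map_add _ _ _
  rw [h2, hc.partialCoef_apply]
  convert h using 2
  ring

end

/-! ### The periodic ODE, the cutoff and the exponential estimates -/

section

/-- With the integrating factor the solution is constant. If `w 0 ≠ 0`, periodicity forces `exp(i
∫_0^{2π} q) = 1`, so the mean of `q` is an integer. -/
theorem eq_zero_of_periodic_of_hasDerivAt {q w : ℝ → ℂ} (hq : Continuous q)
    (hw : ∀ t, HasDerivAt w (-Complex.I * q t * w t) t)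
    (hper : Function.Periodic w (2 * Real.pi))
    (hZ : ¬ ∃ k : ℤ, (2 * Real.pi : ℂ)⁻¹ * ∫ t in (0 : ℝ)..(2 * Real.pi), q t = k) (t : ℝ) :
    w t = 0 := by
  have hQ : ∀ t, HasDerivAt (fun t : ℝ => Complex.exp (Complex.I * ∫ τ in (0 : ℝ)..t, q τ) * w t)
      0 t := by
    intro t
    have h1 : HasDerivAt (fun t => ∫ τ in (0 : ℝ)..t, q τ) (q t) t :=
      intervalIntegral.integral_hasDerivAt_right (hq.intervalIntegrable _ _)
        hq.stronglyMeasurable.stronglyMeasurableAtFilter hq.continuousAt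
    convert! ((h1.const_mul Complex.I).cexp.mul (hw t)) using 1
    ring
  have hconst : ∀ t, Complex.exp (Complex.I * ∫ τ in (0 : ℝ)..t, q τ) * w t = w 0 := by
    intro t
    have := is_const_of_deriv_eq_zero (fun t => (hQ t).differentiableAt) (fun t => (hQ t).deriv) t 0
    simpa using this
  have h0 : w 0 = 0 := by
    by_contra h0
    have h1 := hconst (2 * Real.pi)
    have h2 : w (2 * Real.pi) = w 0 := by simpa using hper 0
    rw [h2] at h1
    have h3 := mul_right_cancel₀ h0 (h1.trans (one_mul _).symm)
    rw [Complex.exp_eq_one_iff] at h3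
    obtain ⟨k, hk⟩ := h3
    refine hZ ⟨k, ?_⟩
    have h4 : (∫ τ in (0 : ℝ)..(2 * Real.pi), q τ) = k * (2 * Real.pi) := by
      apply mul_left_cancel₀ Complex.I_ne_zero
      rw [hk]
      ring
    have : (Real.pi : ℂ) ≠ 0 := by exact_mod_cast Real.pi_ne_zero
    rw [h4]
    field_simp
  have := hconst t
  rw [h0] at this
  simpa using this

/-- The periodic extension of `h` from `[p, p + 2π)`. It agrees with `h` on an open interval longer
than a period, which gives smoothness everywhere, including at the seam. -/
theorem exists_periodic_eq {h : ℝ → ℂ} (hh : ContDiff ℝ ∞ h) {p q : ℝ}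
    (hpq : q < p + 2 * Real.pi) (h0 : ∀ t, t ∉ Set.Icc p q → h t = 0) :
    ∃ g : ℝ → ℂ, ContDiff ℝ ∞ g ∧ Function.Periodic g (2 * Real.pi) ∧
      ∀ t ∈ Set.Ioo (q - 2 * Real.pi) (p + 2 * Real.pi), g t = h t := by
  have hper : Function.Periodic (fun t => h (toIcoMod Real.two_pi_pos p t)) (2 * Real.pi) :=
    fun t => by simp only [toIcoMod_add_right]
  have heq : ∀ t ∈ Set.Ioo (q - 2 * Real.pi) (p + 2 * Real.pi),
      h (toIcoMod Real.two_pi_pos p t) = h t := by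
    intro t ht
    by_cases hp : p ≤ t
    · rw [(toIcoMod_eq_self Real.two_pi_pos).mpr ⟨hp, ht.2⟩]
    -- Here `t + 2π > q`, so `h` vanishes both at `t < p` and at the representative. If even `t + 2π
    -- < p`, then `q < p` and `h` is identically zero.
    · push Not at hp
      have h1 : toIcoMod Real.two_pi_pos p t = toIcoMod Real.two_pi_pos p (t + 2 * Real.pi) := by
        rw [toIcoMod_add_right]
      rw [h1]
      by_cases h2 : p ≤ t + 2 * Real.pi
      · rw [(toIcoMod_eq_self Real.two_pi_pos).mpr ⟨h2, by linarith⟩,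
          h0 _ (fun h => by linarith [h.2, ht.1]), h0 _ (fun h => by linarith [h.1])]
      · have h3 : p ≤ toIcoMod Real.two_pi_pos p (t + 2 * Real.pi) :=
          left_le_toIcoMod Real.two_pi_pos p _
        have h4 : ∀ x, x ∈ Set.Icc p q → False := fun x hx => by
          linarith [hx.1, hx.2, ht.1]
        rw [h0 _ (h4 _), h0 _ (h4 _)]
  refine ⟨_, ?_, hper, heq⟩
  rw [contDiff_iff_contDiffAt]
  intro t
  obtain ⟨k, hk⟩ : ∃ k : ℤ, t + k * (2 * Real.pi) ∈
      Set.Ioo (q - 2 * Real.pi) (p + 2 * Real.pi) := by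
    -- The window is centred at `(p + q) / 2` and longer than `2π`, so it contains `[r, r + 2π)`.
    set r := (p + q) / 2 - Real.pi with hr
    refine ⟨-toIcoDiv Real.two_pi_pos r t, ?_⟩
    have h1 := toIcoMod_mem_Ico Real.two_pi_pos r t
    have h2 : t + ((-toIcoDiv Real.two_pi_pos r t : ℤ) : ℝ) * (2 * Real.pi) =
        toIcoMod Real.two_pi_pos r t := by
      rw [toIcoMod]
      push_cast
      rw [zsmul_eq_mul]
      ring
    rw [h2]
    constructor <;> linarith [h1.1, h1.2]
  have h1 : (fun t => h (toIcoMod Real.two_pi_pos p t)) =ᶠ[nhds t]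
      fun t => h (t + k * (2 * Real.pi)) := by
    have h2 : ∀ᶠ x in nhds t, x + k * (2 * Real.pi) ∈
        Set.Ioo (q - 2 * Real.pi) (p + 2 * Real.pi) :=
      (by fun_prop : Continuous fun x : ℝ => x + k * (2 * Real.pi)).continuousAt.eventually
        (isOpen_Ioo.mem_nhds hk)
    filter_upwards [h2] with x hx
    rw [← heq _ hx]
    exact (hper.int_mul k x).symm
  exact (hh.comp (contDiff_id.add contDiff_const)).contDiffAt.congr_of_eventuallyEq h1

/-- Take `b(p) > 0` and `b(q) < 0` with `p < q < p + 2π`. A primitive of `b` increases just after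
`p` and decreases just before `q`, so its maximum over `[p, q]`, attained at `s`, exceeds both end
values. The cutoff varies only near the ends. Its derivative has to vanish on a neighbourhood, not
just at `t`, for higher derivatives to be controlled. -/
theorem exists_cutoff {b : ℝ → ℝ} (hb : Continuous b) (hper : Function.Periodic b (2 * Real.pi))
    (hneg : ∃ t, b t < 0) (hpos : ∃ t, 0 < b t) :
    ∃ (p q s δ : ℝ) (χ : ℝ → ℝ), q < p + 2 * Real.pi ∧ s ∈ Set.Icc p q ∧ 0 < δ ∧ ContDiff ℝ ∞ χ ∧
      χ s = 1 ∧ (∀ t, t ∉ Set.Icc p q → χ t = 0) ∧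
      ∀ t, deriv χ =ᶠ[nhds t] 0 ∨ ∫ τ in s..t, b τ ≤ -δ := by
  obtain ⟨p, hp⟩ := hpos
  obtain ⟨q', hq'⟩ := hneg
  obtain ⟨q, hq, hqq⟩ := hper.exists_mem_Ico Real.two_pi_pos q' p
  rw [hqq] at hq'
  have hpq : p < q := lt_of_le_of_ne hq.1 (by rintro rfl; linarith)
  have hint : ∀ x y, IntervalIntegrable b MeasureTheory.volume x y := fun x y =>
    hb.intervalIntegrable _ _
  set B : ℝ → ℝ := fun t => ∫ τ in p..t, b τ with hB
  have hBc : Continuous B := intervalIntegral.continuous_primitive (fun x y => hint x y) p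
  have hBsub : ∀ x y, ∫ τ in x..y, b τ = B y - B x := fun x y =>
    (intervalIntegral.integral_interval_sub_left (hint _ _) (hint _ _)).symm
  obtain ⟨s, hs, hmax⟩ := isCompact_Icc.exists_isMaxOn (Set.nonempty_Icc.mpr hpq.le)
    hBc.continuousOn
  have h1 : B p < B s := by
    have h2 : ∀ᶠ x in nhds p, 0 < b x := hb.continuousAt.eventually (lt_mem_nhds hp)
    obtain ⟨ε, hε, h3⟩ := Metric.eventually_nhds_iff.mp h2
    set x := min (p + ε) q with hx
    have hpx : p < x := lt_min (by linarith) hpq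
    have h4 : 0 < ∫ τ in p..x, b τ := by
      refine intervalIntegral.intervalIntegral_pos_of_pos_on (hint _ _) (fun y hy => h3 ?_) hpx
      rw [Real.dist_eq, abs_lt]
      have := min_le_left (p + ε) q
      constructor <;> linarith [hy.1, hy.2]
    rw [hBsub] at h4
    have h5 : B x ≤ B s := hmax ⟨hpx.le, min_le_right _ _⟩
    linarith
  have h2 : B q < B s := by
    have h2 : ∀ᶠ x in nhds q, b x < 0 := hb.continuousAt.eventually (gt_mem_nhds hq')
    obtain ⟨ε, hε, h3⟩ := Metric.eventually_nhds_iff.mp h2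
    set x := max (q - ε) p with hx
    have hxq : x < q := max_lt (by linarith) hpq
    have h4 : 0 < ∫ τ in x..q, -b τ := by
      refine intervalIntegral.intervalIntegral_pos_of_pos_on (hint _ _).neg
        (fun y hy => neg_pos.mpr (h3 ?_)) hxq
      rw [Real.dist_eq, abs_lt]
      have := le_max_left (q - ε) p
      constructor <;> linarith [hy.1, hy.2]
    rw [intervalIntegral.integral_neg, hBsub] at h4
    have h5 : B x ≤ B s := hmax ⟨le_max_right _ _, hxq.le⟩
    linarith
  obtain ⟨δ, hδ, hδp, hδq⟩ : ∃ δ, 0 < δ ∧ B p < B s - δ ∧ B q < B s - δ := by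
    refine ⟨(B s - max (B p) (B q)) / 2, ?_, ?_, ?_⟩ <;>
      rcases le_total (B p) (B q) with h | h <;> simp only [h, max_eq_left, max_eq_right] <;>
      linarith
  obtain ⟨ε₁, hε₁, h3⟩ := Metric.eventually_nhds_iff.mp
    (hBc.continuousAt.eventually (gt_mem_nhds hδp))
  obtain ⟨ε₂, hε₂, h4⟩ := Metric.eventually_nhds_iff.mp
    (hBc.continuousAt.eventually (gt_mem_nhds hδq))
  obtain ⟨ε, hε, hεp, hεq⟩ : ∃ ε, 0 < ε ∧ (∀ x, |x - p| < ε → B x < B s - δ) ∧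
      ∀ x, |x - q| < ε → B x < B s - δ :=
    ⟨min ε₁ ε₂, lt_min hε₁ hε₂, fun x hx => h3 (hx.trans_le (min_le_left _ _)),
      fun x hx => h4 (hx.trans_le (min_le_right _ _))⟩
  -- The transitions take place within `ε / 2` of the ends, so that at every point at distance at
  -- least `ε` from them the cutoff is locally constant.
  have hχ1 : ∀ t, p + ε / 2 ≤ t → t ≤ q - ε / 2 →
      Real.smoothTransition ((t - p) / (ε / 2)) * Real.smoothTransition ((q - t) / (ε / 2)) = 1 := by
    intro t h5 h6
    rw [Real.smoothTransition.one_of_one_le, Real.smoothTransition.one_of_one_le, one_mul]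
    · rw [le_div_iff₀ (by linarith)]
      linarith
    · rw [le_div_iff₀ (by linarith)]
      linarith
  have hχ0 : ∀ t, t ∉ Set.Icc p q →
      Real.smoothTransition ((t - p) / (ε / 2)) * Real.smoothTransition ((q - t) / (ε / 2)) = 0 := by
    intro t ht
    by_cases h5 : p ≤ t
    · have h6 : q < t := by
        by_contra h6
        exact ht ⟨h5, not_lt.mp h6⟩
      rw [Real.smoothTransition.zero_of_nonpos (x := (q - t) / (ε / 2)), mul_zero]
      exact div_nonpos_of_nonpos_of_nonneg (by linarith) (by linarith)
    · rw [Real.smoothTransition.zero_of_nonpos, zero_mul]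
      exact div_nonpos_of_nonpos_of_nonneg (by linarith) (by linarith)
  have hsp : ε ≤ |s - p| := by
    by_contra h
    linarith [hεp s (not_le.mp h)]
  have hsq : ε ≤ |s - q| := by
    by_contra h
    linarith [hεq s (not_le.mp h)]
  rw [abs_of_nonneg (by linarith [hs.1])] at hsp
  rw [abs_of_nonpos (by linarith [hs.2])] at hsq
  refine ⟨p, q, s, δ, fun t => Real.smoothTransition ((t - p) / (ε / 2)) *
    Real.smoothTransition ((q - t) / (ε / 2)), hq.2, hs, hδ, ?_, hχ1 s (by linarith) (by linarith),
    hχ0, fun t => ?_⟩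
  · exact (Real.smoothTransition.contDiff.comp (by fun_prop)).mul
      (Real.smoothTransition.contDiff.comp (by fun_prop))
  · have hloc : ∀ a : ℝ, (fun t => Real.smoothTransition ((t - p) / (ε / 2)) *
        Real.smoothTransition ((q - t) / (ε / 2))) =ᶠ[nhds t] (fun _ => a) →
        deriv (fun t => Real.smoothTransition ((t - p) / (ε / 2)) *
        Real.smoothTransition ((q - t) / (ε / 2))) =ᶠ[nhds t] 0 := by
      intro a ha
      refine ha.deriv.trans (Filter.Eventually.of_forall fun x => ?_)
      simp
    by_cases ht : t ∈ Set.Icc p q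
    · by_cases h5 : |t - p| < ε
      · right
        rw [hBsub]
        linarith [hεp t h5]
      by_cases h6 : |t - q| < ε
      · right
        rw [hBsub]
        linarith [hεq t h6]
      left
      rw [abs_of_nonneg (by linarith [ht.1])] at h5
      rw [abs_of_nonpos (by linarith [ht.2])] at h6
      refine hloc 1 ?_
      filter_upwards [isOpen_Ioo.mem_nhds (show t ∈ Set.Ioo (p + ε / 2) (q - ε / 2) from
        ⟨by linarith, by linarith⟩)] with x hx
      exact hχ1 x hx.1.le hx.2.le
    · left
      refine hloc 0 ?_
      filter_upwards [isClosed_Icc.isOpen_compl.mem_nhds ht] with x hx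
      exact hχ0 x hx

theorem ContDiff.exists_norm_iteratedFDeriv_le {E F : Type*} [NormedAddCommGroup E]
    [NormedSpace ℝ E] [NormedAddCommGroup F] [NormedSpace ℝ F] {f : E → F} (hf : ContDiff ℝ ∞ f)
    {K : Set E} (hK : IsCompact K) (k : ℕ) :
    ∃ C, 1 ≤ C ∧ ∀ i ≤ k, ∀ y ∈ K, ‖iteratedFDeriv ℝ i f y‖ ≤ C := by
  have h : ∀ i : ℕ, ∃ C, ∀ y ∈ K, ‖iteratedFDeriv ℝ i f y‖ ≤ C := fun i =>
    hK.exists_bound_of_continuousOn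
      (hf.continuous_iteratedFDeriv (by exact_mod_cast le_top)).continuousOn
  choose C hC using h
  refine ⟨1 + ∑ i ∈ Finset.range (k + 1), |C i|, ?_, fun i hi y hy => ?_⟩
  · have : 0 ≤ ∑ i ∈ Finset.range (k + 1), |C i| := Finset.sum_nonneg fun _ _ => abs_nonneg _
    linarith
  · have h1 : |C i| ≤ ∑ i ∈ Finset.range (k + 1), |C i| :=
      Finset.single_le_sum (f := fun i => |C i|) (fun _ _ => abs_nonneg _)
        (Finset.mem_range.mpr (by omega))
    linarith [hC i y hy, le_abs_self (C i)]

/-- Each derivative costs at most a factor of order `M`, and where `X` is not locally zero the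
exponential is at most `e^{-δM}`. The constant has to be uniform in `M` and `a`, which become `n^m`
and `n`. -/
theorem exists_norm_iteratedFDeriv_mul_cexp_le {E : Type*} [NormedAddCommGroup E]
    [NormedSpace ℝ E] {X A L : E → ℂ} (hX : ContDiff ℝ ∞ X) (hA : ContDiff ℝ ∞ A)
    (hL : ContDiff ℝ ∞ L) {K : Set E} (hK : IsCompact K) {δ : ℝ} (hLre : ∀ y, (L y).re = 0)
    (hδ : ∀ y, X =ᶠ[nhds y] 0 ∨ (A y).re ≤ -δ) (k : ℕ) :
    ∃ C, 0 ≤ C ∧ ∀ M a : ℝ, 1 ≤ M → 0 ≤ a → a ≤ M → ∀ y ∈ K,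
      ‖iteratedFDeriv ℝ k (fun y => X y * Complex.exp (M • A y + a • L y)) y‖ ≤
        C * (M ^ k * Real.exp (-(δ * M))) := by
  obtain ⟨CX, hCX1, hCX⟩ := hX.exists_norm_iteratedFDeriv_le hK k
  obtain ⟨CA, hCA1, hCA⟩ := hA.exists_norm_iteratedFDeriv_le hK k
  obtain ⟨CL, hCL1, hCL⟩ := hL.exists_norm_iteratedFDeriv_le hK k
  refine ⟨2 ^ k * (CX * (k.factorial * (CA + CL) ^ k)), by positivity, ?_⟩
  intro M a hM ha haM y hy
  rcases hδ y with h0 | hre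
  · have h1 : (fun y => X y * Complex.exp (M • A y + a • L y)) =ᶠ[nhds y] fun _ => 0 := by
      filter_upwards [h0] with x hx
      rw [hx, Pi.zero_apply, zero_mul]
    rw [(h1.iteratedFDeriv ℝ k).eq_of_nhds, iteratedFDeriv_fun_zero, Pi.zero_apply, norm_zero]
    positivity
  have hf : ContDiff ℝ ∞ fun y => M • A y + a • L y := (hA.const_smul M).add (hL.const_smul a)
  -- A single bound for the derivatives of the phase; as `R ≥ 1` it is also at most `R ^ i` for `i ≥
  -- 1`.
  set R := M * (CA + CL) with hR
  have hR1 : 1 ≤ R := by nlinarith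
  have hD : ∀ i, 1 ≤ i → i ≤ k → ‖iteratedFDeriv ℝ i (fun y => M • A y + a • L y) y‖ ≤ R ^ i := by
    intro i hi1 hi
    have e : (fun y => M • A y + a • L y) = M • A + a • L := rfl
    have hA' : ContDiffAt ℝ i A y := hA.contDiffAt.of_le (by exact_mod_cast le_top)
    have hL' : ContDiffAt ℝ i L y := hL.contDiffAt.of_le (by exact_mod_cast le_top)
    rw [e, iteratedFDeriv_add_apply (f := M • A) (g := a • L) (hA'.const_smul M) (hL'.const_smul a),
      iteratedFDeriv_const_smul_apply hA', iteratedFDeriv_const_smul_apply hL']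
    calc _ ≤ ‖M • iteratedFDeriv ℝ i A y‖ + ‖a • iteratedFDeriv ℝ i L y‖ := norm_add_le _ _
      _ ≤ M * CA + M * CL := by
          rw [norm_smul, norm_smul, Real.norm_of_nonneg ha, Real.norm_of_nonneg (by linarith)]
          gcongr
          · exact hCA i hi y hy
          · exact hCL i hi y hy
      _ = R := by rw [hR]; ring
      _ ≤ R ^ i := le_self_pow₀ hR1 (by omega)
  have hexp : ∀ j ≤ k, ‖iteratedFDeriv ℝ j (fun y => Complex.exp (M • A y + a • L y)) y‖ ≤
      k.factorial * Real.exp (-(δ * M)) * R ^ k := by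
    intro j hj
    refine (norm_iteratedFDeriv_cexp_comp_le hf j y fun i h1 h2 => hD i h1 (h2.trans hj)).trans ?_
    have h1 : (M • A y + a • L y).re ≤ -(δ * M) := by
      simp only [Complex.add_re, Complex.real_smul, Complex.re_ofReal_mul, hLre, mul_zero,
        add_zero]
      nlinarith
    have h2 : (j.factorial : ℝ) ≤ k.factorial := by exact_mod_cast Nat.factorial_le hj
    have h3 : R ^ j ≤ R ^ k := pow_le_pow_right₀ hR1 hj
    gcongr
  calc _ ≤ ∑ i ∈ Finset.range (k + 1), (k.choose i : ℝ) * ‖iteratedFDeriv ℝ i X y‖ *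
        ‖iteratedFDeriv ℝ (k - i) (fun y => Complex.exp (M • A y + a • L y)) y‖ :=
        norm_iteratedFDeriv_mul_le (N := ∞) hX (Complex.contDiff_exp.comp hf) y
          (by exact_mod_cast le_top)
    _ ≤ ∑ i ∈ Finset.range (k + 1), (k.choose i : ℝ) * CX *
        (k.factorial * Real.exp (-(δ * M)) * R ^ k) := by
        refine Finset.sum_le_sum fun i hi => ?_
        have hi' : i ≤ k := Nat.lt_succ_iff.mp (Finset.mem_range.mp hi)
        have h1 := hCX i hi' y hy
        have h2 := hexp (k - i) (Nat.sub_le _ _)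
        gcongr
    _ = _ := by
        rw [← Finset.sum_mul, ← Finset.sum_mul]
        have : (∑ i ∈ Finset.range (k + 1), (k.choose i : ℝ)) = 2 ^ k := by
          exact_mod_cast Nat.sum_range_choose k
        rw [this, hR, mul_pow]
        ring

theorem exists_pow_mul_exp_neg_le {δ : ℝ} (hδ : 0 < δ) (k : ℕ) :
    ∃ C, 0 ≤ C ∧ ∀ M : ℝ, 0 < M → M ^ k * Real.exp (-(δ * M)) ≤ C * (M ^ 2)⁻¹ := by
  refine ⟨(k + 2).factorial / δ ^ (k + 2), by positivity, fun M hM => ?_⟩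
  have h := Real.pow_div_factorial_le_exp (δ * M) (by positivity) (k + 2)
  rw [Real.exp_neg, ← div_eq_mul_inv, ← div_eq_mul_inv, div_le_div_iff₀ (by positivity)
    (by positivity)]
  rw [div_le_iff₀ (by positivity)] at h
  rw [div_mul_eq_mul_div, le_div_iff₀ (by positivity)]
  calc _ = (δ * M) ^ (k + 2) := by ring
    _ ≤ _ := h
    _ = _ := by ring

end

/-! ### Single modes and approximate null solutions -/

section

open TorusSmooth

variable {N : ℕ} {c : TorusSmooth (N + 1) →L[ℂ] TorusSmooth (N + 1)}

namespace TorusSmooth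

/-- The function `g(t) e^{i x·ξ}`. -/
def mode (g : ℝ → ℂ) (hg : ContDiff ℝ ∞ g) (hp : Function.Periodic g (2 * Real.pi))
    (ξ : Fin N → ℤ) : TorusSmooth (N + 1) :=
  mk (fun y => g (y 0) * torusExp (Fin.cons 0 ξ) y)
    ((hg.comp (contDiff_apply ℝ ℝ 0)).mul (torusExp (Fin.cons 0 ξ)).contDiff)
    (fun j y => by
      have h1 : g ((y + Pi.single j (2 * Real.pi) : Fin (N + 1) → ℝ) 0) = g (y 0) := by
        refine Fin.cases ?_ (fun j => ?_) j
        · simpa using hp (y 0)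
        · simp
      exact congrArg₂ _ h1 ((torusExp (Fin.cons 0 ξ)).periodic j y))

variable {g : ℝ → ℂ} {hg : ContDiff ℝ ∞ g} {hp : Function.Periodic g (2 * Real.pi)}
  {ξ : Fin N → ℤ}

theorem mode_apply (y : Fin (N + 1) → ℝ) :
    mode g hg hp ξ y = g (y 0) * torusExp (Fin.cons 0 ξ) y := rfl

theorem torusExp_cons_zero_apply (ξ : Fin N → ℤ) (t : ℝ) (x : Fin N → ℝ) :
    torusExp (Fin.cons 0 ξ) (Fin.cons t x) = torusExp ξ x := by
  rw [torusExp_apply, torusExp_apply, Fin.sum_univ_succ]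
  simp

theorem slice_mode (t : ℝ) : slice t (mode g hg hp ξ) = g t • torusExp ξ := by
  ext x
  rw [slice_apply, mode_apply, smul_apply, torusExp_cons_zero_apply, Fin.cons_zero]

theorem partialCoef_mode_self (t : ℝ) : partialCoef t ξ (mode g hg hp ξ) = g t := by
  rw [partialCoef_apply, slice_mode, coef_smul, coef_torusExp_self, mul_one]

end TorusSmooth

theorem IsTubeType.apply_mode (hc : IsTubeType c) {g : ℝ → ℂ} (hg : ContDiff ℝ ∞ g)
    (hp : Function.Periodic g (2 * Real.pi)) (ξ : Fin N → ℤ) (y : Fin (N + 1) → ℝ) :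
    c (mode g hg hp ξ) y = tubeSymbol c (y 0) ξ * mode g hg hp ξ y := by
  refine hc.apply_of_translate (fun j s y => ?_) y
  rw [mode_apply, mode_apply, torusExp_add_apply, torusExp_single]
  simp only [Pi.add_apply, Fin.cons_succ, ne_eq, (Fin.succ_ne_zero j).symm, not_false_eq_true,
    Pi.single_eq_of_ne, add_zero]
  ring

theorem IsTubeType.tubeOperator_mode (hc : IsTubeType c) {g : ℝ → ℂ} (hg : ContDiff ℝ ∞ g)
    (hp : Function.Periodic g (2 * Real.pi)) (ξ : Fin N → ℤ) (y : Fin (N + 1) → ℝ) :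
    tubeOperator c (mode g hg hp ξ) y =
      (-Complex.I * deriv g (y 0) + tubeSymbol c (y 0) ξ * g (y 0)) *
        torusExp (Fin.cons 0 ξ) y := by
  have h1 : tubeOperator c (mode g hg hp ξ) y =
      D 0 (mode g hg hp ξ) y + c (mode g hg hp ξ) y := rfl
  have h2 : HasDerivAt (fun s : ℝ => mode g hg hp ξ (y + Pi.single 0 s))
      (fderiv ℝ (mode g hg hp ξ) (y + Pi.single 0 0) (Pi.single 0 1)) 0 :=
    ((mode g hg hp ξ).contDiff.differentiable (by simp) _).hasFDerivAt.comp_hasDerivAt 0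
      ((hasDerivAt_single (0 : Fin (N + 1)) (0 : ℝ)).const_add y)
  have h3 : ∀ s : ℝ, mode g hg hp ξ (y + Pi.single 0 s) =
      g (y 0 + s) * torusExp (Fin.cons 0 ξ) y := by
    intro s
    rw [mode_apply, torusExp_add_apply, torusExp_single]
    simp
  have h4 : HasDerivAt (fun s : ℝ => g (y 0 + s) * torusExp (Fin.cons 0 ξ) y)
      (deriv g (y 0) * torusExp (Fin.cons 0 ξ) y) 0 := by
    refine HasDerivAt.mul_const ?_ _
    have h5 : HasDerivAt g (deriv g (y 0)) (y 0 + 0) := by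
      rw [add_zero]
      exact (hg.differentiable (by simp) _).hasDerivAt
    exact h5.comp_const_add (y 0) 0
  simp_rw [h3] at h2
  have h5 := h2.unique h4
  rw [Pi.single_zero, add_zero] at h5
  have h6 : D 0 (mode g hg hp ξ) y =
      -Complex.I * fderiv ℝ (mode g hg hp ξ) y (Pi.single 0 1) := rfl
  rw [h1, h6, h5, hc.apply_mode, mode_apply]
  ring

/-- Two functions with the same image under `P` have the same partial Fourier coefficient at every
`ξ` for which the average of the symbol is not an integer. -/
theorem IsTubeType.partialCoef_eq_of_tubeOperator (hc : IsTubeType c) {ξ : Fin N → ℤ}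
    (hξ : ξ ∉ integerAverageSet c) {v w : TorusSmooth (N + 1)}
    (h : ∀ t, partialCoef t ξ (tubeOperator c v) = partialCoef t ξ (tubeOperator c w)) (t : ℝ) :
    partialCoef t ξ v = partialCoef t ξ w := by
  refine sub_eq_zero.mp (eq_zero_of_periodic_of_hasDerivAt (q := fun t => tubeSymbol c t ξ)
    (w := fun t => partialCoef t ξ v - partialCoef t ξ w) (contDiff_tubeSymbol c ξ).continuous
    (fun t => ?_) (fun t => ?_) hξ t)
  · convert! (hc.hasDerivAt_partialCoef t ξ v).sub (hc.hasDerivAt_partialCoef t ξ w) using 1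
    rw [h]
    ring
  · simp only [partialCoef_add_two_pi]

/-- Reduces estimates on the torus to a compact cube whose corner `r` is free, so that the
`t`-coordinate can be kept in the window where a periodic extension is explicit. -/
theorem TorusSmooth.exists_shift (r : ℝ) (y : Fin (N + 1) → ℝ) :
    ∃ z : Fin (N + 1) → ℝ, z ∈ Set.Icc (fun _ => r) (fun _ => r + 2 * Real.pi) ∧
      ∀ {F : Type} (f : (Fin (N + 1) → ℝ) → F), IsTorusPeriodic f → f y = f z := by
  refine ⟨fun j => toIcoMod Real.two_pi_pos r (y j),
    ⟨fun j => (toIcoMod_mem_Ico _ _ _).1, fun j => (toIcoMod_mem_Ico _ _ _).2.le⟩, ?_⟩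
  intro F f hf
  rw [← hf.add_int (fun j => toIcoDiv Real.two_pi_pos r (y j)) fun j =>
    toIcoMod Real.two_pi_pos r (y j)]
  exact congrArg f (funext fun j => (toIcoMod_add_toIcoDiv_mul Real.two_pi_pos r (y j)).symm)

theorem tubeSymbol_nsmul {m : ℕ} (hhom : IsPosHomogeneous m c) (ξ : Fin N → ℤ) {n : ℕ}
    (hn : 0 < n) (t : ℝ) : tubeSymbol c t (n • ξ) = (n : ℂ) ^ m * tubeSymbol c t ξ :=
  hhom.2 t ξ n hn

theorem symbolAverage_nsmul {m : ℕ} (hhom : IsPosHomogeneous m c) (ξ : Fin N → ℤ) {n : ℕ}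
    (hn : 0 < n) : symbolAverage c (n • ξ) = (n : ℂ) ^ m * symbolAverage c ξ := by
  simp only [symbolAverage, tubeSymbol_nsmul hhom ξ hn, intervalIntegral.integral_const_mul]
  ring

theorem imSymbol_nsmul {m : ℕ} (hhom : IsPosHomogeneous m c) (ξ : Fin N → ℤ) {n : ℕ}
    (hn : 0 < n) (t : ℝ) : imSymbol c t (n • ξ) = (n : ℝ) ^ m * imSymbol c t ξ := by
  have h : ((n : ℂ) ^ m) = (((n : ℝ) ^ m : ℝ) : ℂ) := by push_cast; rfl
  rw [imSymbol, tubeSymbol_nsmul hhom ξ hn, h, Complex.im_ofReal_mul, imSymbol]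

theorem imPrimitive_nsmul {m : ℕ} (hhom : IsPosHomogeneous m c) (ξ : Fin N → ℤ) {n : ℕ}
    (hn : 0 < n) (t : ℝ) : imPrimitive c t (n • ξ) = (n : ℝ) ^ m * imPrimitive c t ξ := by
  simp only [imPrimitive, imSymbol_nsmul hhom ξ hn, intervalIntegral.integral_const_mul]

theorem continuous_imSymbol (c : TorusSmooth (N + 1) →L[ℂ] TorusSmooth (N + 1))
    (ξ : Fin N → ℤ) : Continuous fun t => imSymbol c t ξ :=
  Complex.continuous_im.comp (contDiff_tubeSymbol c ξ).continuous

theorem imSymbol_periodic (c : TorusSmooth (N + 1) →L[ℂ] TorusSmooth (N + 1))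
    (ξ : Fin N → ℤ) : Function.Periodic (fun t => imSymbol c t ξ) (2 * Real.pi) := fun t => by
  have := tubeSymbol_periodic c ξ t
  simp only at this
  simp only [imSymbol, this]

/-- If `b(·, ξ₀)` changes sign there are functions `g_n` with `|g_n(s)| = 1` at a fixed point `s`
for which `P (g_n(t) e^{i x·nξ₀})` is exponentially small. -/
theorem exists_almost_null_modes {m : ℕ} (hm : 1 ≤ m) (hc : IsTubeType c)
    (hhom : IsPosHomogeneous m c) {ξ₀ : Fin N → ℤ} (hneg : ∃ t, imSymbol c t ξ₀ < 0)
    (hpos : ∃ t, 0 < imSymbol c t ξ₀) :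
    ∃ (s : ℝ) (u : ℕ → TorusSmooth (N + 1)), (∀ n, partialCoef s (n • ξ₀) (u n) = 1) ∧
      (∀ n t, ∃ a : ℂ, slice t (tubeOperator c (u n)) = a • torusExp (n • ξ₀)) ∧
      ∀ k, ∃ C, ∀ n : ℕ, 0 < n →
        seminorm (N + 1) k (tubeOperator c (u n)) ≤ C * ((n : ℝ) ^ 2)⁻¹ := by
  obtain ⟨p, q, s, δ, χ, hqp, hs, hδ, hχ, hχs, hχ0, hχ'⟩ :=
    exists_cutoff (continuous_imSymbol c ξ₀) (imSymbol_periodic c ξ₀) hneg hpos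
  have hσ := (contDiff_tubeSymbol c ξ₀).continuous
  -- By homogeneity `D_t + c(t, nξ₀)` annihilates `exp(n^m Φ)`, so applying it to `χ exp(n^m Φ)`
  -- leaves only the term with `χ'`.
  set Φ : ℝ → ℂ := fun t => -Complex.I * ∫ τ in s..t, tubeSymbol c τ ξ₀ with hΦ
  have hΦ' : ∀ t, HasDerivAt Φ (-Complex.I * tubeSymbol c t ξ₀) t := fun t =>
    (intervalIntegral.integral_hasDerivAt_right (hσ.intervalIntegrable _ _)
        hσ.stronglyMeasurable.stronglyMeasurableAtFilter hσ.continuousAt).const_mul _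
  have hΦc : ContDiff ℝ ∞ Φ := by
    rw [contDiff_infty_iff_deriv]
    refine ⟨fun t => (hΦ' t).differentiableAt, ?_⟩
    have : deriv Φ = fun t => -Complex.I * tubeSymbol c t ξ₀ := funext fun t => (hΦ' t).deriv
    rw [this]
    exact contDiff_const.mul (contDiff_tubeSymbol c ξ₀)
  have hΦre : ∀ t, (Φ t).re = ∫ τ in s..t, imSymbol c τ ξ₀ := by
    intro t
    have h1 : (∫ τ in s..t, tubeSymbol c τ ξ₀).im = ∫ τ in s..t, imSymbol c τ ξ₀ :=
      (Complex.imCLM.intervalIntegral_comp_comm (hσ.intervalIntegrable _ _)).symm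
    rw [hΦ, ← h1]
    simp
  have hχc : ContDiff ℝ ∞ fun t => (χ t : ℂ) := Complex.ofRealCLM.contDiff.comp hχ
  set h : ℕ → ℝ → ℂ := fun n t => χ t * Complex.exp (((n : ℝ) ^ m) • Φ t) with hh
  have hhc : ∀ n, ContDiff ℝ ∞ (h n) := fun n =>
    hχc.mul (Complex.contDiff_exp.comp (hΦc.const_smul ((n : ℝ) ^ m)))
  have hex : ∀ n, ∃ g : ℝ → ℂ, ContDiff ℝ ∞ g ∧ Function.Periodic g (2 * Real.pi) ∧
      ∀ t ∈ Set.Ioo (q - 2 * Real.pi) (p + 2 * Real.pi), g t = h n t := fun n =>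
    exists_periodic_eq (hhc n) hqp fun t ht => by simp only [hh, hχ0 t ht]; simp
  choose g hg hgp hgh using hex
  have hpi := Real.pi_pos
  refine ⟨s, fun n => mode (g n) (hg n) (hgp n) (n • ξ₀), fun n => ?_, fun n t => ?_, fun k => ?_⟩
  · rw [partialCoef_mode_self, hgh n s ⟨by linarith [hs.1], by linarith [hs.2]⟩]
    simp [hh, hχs, hΦ]
  · refine ⟨-Complex.I * deriv (g n) t + tubeSymbol c t (n • ξ₀) * g n t, ?_⟩
    ext x
    rw [slice_apply, hc.tubeOperator_mode, smul_apply, torusExp_cons_zero_apply, Fin.cons_zero]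
  · set r := (p + q) / 2 - Real.pi with hr
    have hX : ContDiff ℝ ∞ fun y : Fin (N + 1) → ℝ => -Complex.I * ((deriv χ (y 0) : ℝ) : ℂ) :=
      contDiff_const.mul (Complex.ofRealCLM.contDiff.comp
        ((contDiff_infty_iff_deriv.mp hχ).2.comp (contDiff_apply ℝ ℝ 0)))
    have hA : ContDiff ℝ ∞ fun y : Fin (N + 1) → ℝ => Φ (y 0) :=
      hΦc.comp (contDiff_apply ℝ ℝ 0)
    obtain ⟨C, hC0, hC⟩ := exists_norm_iteratedFDeriv_mul_cexp_le hX hA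
      (torusPhase (Fin.cons 0 ξ₀)).contDiff
      (isCompact_Icc (a := fun _ : Fin (N + 1) => r) (b := fun _ => r + 2 * Real.pi)) (δ := δ)
      (fun y => by rw [torusPhase_apply]; simp)
      (fun y => by
        rcases hχ' (y 0) with h1 | h1
        · left
          have h2 := ((continuous_apply (0 : Fin (N + 1))).continuousAt (x := y)).eventually h1
          filter_upwards [h2] with z hz
          simp [hz]
        · right
          rwa [hΦre]) k
    obtain ⟨C', hC'0, hC'⟩ := exists_pow_mul_exp_neg_le hδ k
    refine ⟨C * C', fun n hn => seminorm_le fun y => ?_⟩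
    have hn1 : (1 : ℝ) ≤ n := by exact_mod_cast hn
    have hM : (n : ℝ) ≤ (n : ℝ) ^ m := le_self_pow₀ hn1 (by omega)
    obtain ⟨z, hz, hyz⟩ := exists_shift r y
    rw [hyz _ ((tubeOperator c (mode (g n) (hg n) (hgp n) (n • ξ₀))).periodic.iteratedFDeriv k)]
    have hz0 : z 0 ∈ Set.Ioo (q - 2 * Real.pi) (p + 2 * Real.pi) := by
      have h1 := hz.1 0
      have h2 := hz.2 0
      simp only at h1 h2
      constructor <;> linarith
    have hloc : (tubeOperator c (mode (g n) (hg n) (hgp n) (n • ξ₀)) : (Fin (N + 1) → ℝ) → ℂ)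
        =ᶠ[nhds z] fun y => -Complex.I * ((deriv χ (y 0) : ℝ) : ℂ) *
          Complex.exp (((n : ℝ) ^ m) • Φ (y 0) + (n : ℝ) • torusPhase (Fin.cons 0 ξ₀) y) := by
      filter_upwards [(continuous_apply (0 : Fin (N + 1))).continuousAt.eventually
        (isOpen_Ioo.mem_nhds hz0)] with w hw
      have hgw : g n =ᶠ[nhds (w 0)] h n := by
        filter_upwards [isOpen_Ioo.mem_nhds hw] with t ht
        exact hgh n t ht
      have hd : HasDerivAt (h n) (((deriv χ (w 0) : ℝ) : ℂ) *
          Complex.exp (((n : ℝ) ^ m) • Φ (w 0)) + χ (w 0) * (Complex.exp (((n : ℝ) ^ m) • Φ (w 0)) *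
          (((n : ℝ) ^ m) • (-Complex.I * tubeSymbol c (w 0) ξ₀)))) (w 0) :=
        ((hχ.differentiable (by simp) _).hasDerivAt.ofReal_comp).mul
          (((hΦ' (w 0)).const_smul ((n : ℝ) ^ m)).cexp)
      have hexp : torusExp (Fin.cons 0 (n • ξ₀)) w =
          Complex.exp ((n : ℝ) • torusPhase (Fin.cons 0 ξ₀) w) := by
        rw [torusExp_apply, torusPhase_apply, Fin.sum_univ_succ, Fin.sum_univ_succ]
        congr 1
        simp only [Fin.cons_zero, Fin.cons_succ, Pi.smul_apply, Complex.real_smul]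
        simp only [nsmul_eq_mul, Complex.ofReal_add, Complex.ofReal_sum, Finset.mul_sum, mul_add]
        push_cast
        congr 1
        · ring
        · exact Finset.sum_congr rfl fun i _ => by ring
      rw [hc.tubeOperator_mode, hgw.deriv_eq, hgw.eq_of_nhds, hd.deriv,
        tubeSymbol_nsmul hhom ξ₀ hn, hexp, Complex.exp_add]
      simp only [hh, Complex.real_smul]
      push_cast
      linear_combination (χ (w 0) * Complex.exp ((n : ℂ) ^ m * Φ (w 0)) * (n : ℂ) ^ m *
        tubeSymbol c (w 0) ξ₀ * Complex.exp (n * torusPhase (Fin.cons 0 ξ₀) w)) *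
        Complex.I_mul_I
    rw [(hloc.iteratedFDeriv ℝ k).eq_of_nhds]
    have hn0 : (0 : ℝ) < n := by linarith
    -- The estimate with `M = n^m` and `a = n`; `m ≥ 1` gives `a ≤ M`, and also `M⁻² ≤ n⁻²`.
    calc _ ≤ C * (((n : ℝ) ^ m) ^ k * Real.exp (-(δ * (n : ℝ) ^ m))) :=
          hC _ _ (hn1.trans hM) hn0.le hM z hz
      _ ≤ C * (C' * ((((n : ℝ) ^ m)) ^ 2)⁻¹) := by
          exact mul_le_mul_of_nonneg_left (hC' _ (pow_pos hn0 m)) hC0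
      _ ≤ C * (C' * ((n : ℝ) ^ 2)⁻¹) := by
          gcongr
      _ = _ := by ring

end

/-! ### Failure of the conditions `(α)` and of global solvability -/

section

open TorusSmooth

variable {N : ℕ} {c : TorusSmooth (N + 1) →L[ℂ] TorusSmooth (N + 1)}

theorem latticeNorm_nsmul (n : ℕ) (ξ : Fin N → ℤ) :
    latticeNorm (n • ξ) = n * latticeNorm ξ := by
  have h : ∑ j, (((n • ξ) j : ℤ) : ℝ) ^ 2 = (n : ℝ) ^ 2 * ∑ j, (ξ j : ℝ) ^ 2 := by
    rw [Finset.mul_sum]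
    refine Finset.sum_congr rfl fun j _ => ?_
    rw [Pi.smul_apply, nsmul_eq_mul]
    push_cast
    ring
  rw [latticeNorm, h, Real.sqrt_mul (sq_nonneg _), Real.sqrt_sq (Nat.cast_nonneg n), latticeNorm]

theorem latticeNorm_pos {ξ : Fin N → ℤ} (hξ : ξ ≠ 0) : 0 < latticeNorm ξ := by
  obtain ⟨j, hj⟩ := Function.ne_iff.mp hξ
  have hj' : (ξ j : ℝ) ≠ 0 := by exact_mod_cast hj
  refine Real.sqrt_pos.mpr (Finset.sum_pos' (fun _ _ => sq_nonneg _) ⟨j, Finset.mem_univ _, ?_⟩)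
  positivity

/-- Of two consecutive integers at least one works: `(a+1)^m` and `(a+2)^m` are coprime, so if both
multiples of `c_0(ξ)` were integers, a Bézout combination would make `c_0(ξ)` an integer. -/
theorem frequently_nsmul_notMem_integerAverageSet {m : ℕ} (hhom : IsPosHomogeneous m c)
    {ξ : Fin N → ℤ} (hξ : ξ ∉ integerAverageSet c) :
    ∃ᶠ n : ℕ in Filter.atTop, 0 < n ∧ n • ξ ∉ integerAverageSet c := by
  rw [Filter.frequently_atTop]
  intro a
  by_contra! h
  obtain ⟨k, hk⟩ := h (a + 1) (by omega) (by omega)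
  obtain ⟨l, hl⟩ := h (a + 2) (by omega) (by omega)
  rw [symbolAverage_nsmul hhom ξ (by omega)] at hk hl
  have hcop : IsCoprime (((a + 1 : ℕ) : ℤ) ^ m) (((a + 2 : ℕ) : ℤ) ^ m) := by
    refine IsCoprime.pow ?_
    refine ⟨-1, 1, ?_⟩
    push_cast
    ring
  obtain ⟨x, y, hxy⟩ := hcop
  refine hξ ⟨x * k + y * l, ?_⟩
  have hxy' : (x : ℂ) * ((a + 1 : ℕ) : ℂ) ^ m + y * ((a + 2 : ℕ) : ℂ) ^ m = 1 := by
    exact_mod_cast hxy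
  push_cast at hxy' hk hl ⊢
  linear_combination (-symbolAverage c ξ) * hxy' + x * hk + y * hl

theorem eventually_rpow_neg_le {m : ℕ} (hm : 1 ≤ m) {ξ : Fin N → ℤ} (hξ : ξ ≠ 0) {r : ℝ}
    (hr : 0 < r) : ∀ᶠ n : ℕ in Filter.atTop, latticeNorm (n • ξ) ^ (-(m : ℝ)) ≤ r := by
  have h1 : Filter.Tendsto (fun n : ℕ => latticeNorm (n • ξ)) Filter.atTop Filter.atTop := by
    simp_rw [latticeNorm_nsmul]
    exact tendsto_natCast_atTop_atTop.atTop_mul_const (latticeNorm_pos hξ)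
  have h2 := (tendsto_rpow_neg_atTop (y := (m : ℝ)) (by exact_mod_cast hm)).comp h1
  exact (h2.eventually (gt_mem_nhds hr)).mono fun n hn => le_of_lt hn

theorem eventually_mul_log_lt {m : ℕ} (hm : 1 ≤ m) {ξ : Fin N → ℤ} (hξ : ξ ≠ 0) (D : ℝ) {κ : ℝ}
    (hκ : 0 < κ) :
    ∀ᶠ n : ℕ in Filter.atTop, D * Real.log (latticeNorm (n • ξ)) < (n : ℝ) ^ m * κ := by
  have hpos := latticeNorm_pos hξ
  have h1 : Filter.Tendsto (fun n : ℕ => latticeNorm (n • ξ)) Filter.atTop Filter.atTop := by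
    simp_rw [latticeNorm_nsmul]
    exact tendsto_natCast_atTop_atTop.atTop_mul_const hpos
  -- This constant bounds `D log |nξ|` by `nκ / 2`, which is strictly below `n^m κ`.
  have h2 := (Real.isLittleO_log_id_atTop.const_mul_left D).def
    (c := κ / (2 * latticeNorm ξ)) (by positivity)
  filter_upwards [h1.eventually h2, Filter.eventually_gt_atTop 0] with n hn hn0
  have hn1 : (1 : ℝ) ≤ n := by exact_mod_cast hn0
  have hM : (n : ℝ) ≤ (n : ℝ) ^ m := le_self_pow₀ hn1 (by omega)
  rw [id, latticeNorm_nsmul, Real.norm_of_nonneg (by positivity : 0 ≤ (n : ℝ) * latticeNorm ξ)]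
    at hn
  rw [latticeNorm_nsmul]
  calc _ ≤ _ := Real.le_norm_self _
    _ ≤ _ := hn
    _ = n * κ / 2 := by field_simp
    _ < (n : ℝ) ^ m * κ := by nlinarith

theorem imPrimitive_sub (c : TorusSmooth (N + 1) →L[ℂ] TorusSmooth (N + 1)) (ξ : Fin N → ℤ)
    (s t : ℝ) : imPrimitive c t ξ - imPrimitive c s ξ = ∫ τ in s..t, imSymbol c τ ξ :=
  intervalIntegral.integral_interval_sub_left
    ((continuous_imSymbol c ξ).intervalIntegrable _ _)
    ((continuous_imSymbol c ξ).intervalIntegrable _ _)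

theorem mul_sub_le_integral {b : ℝ → ℝ} (hb : Continuous b) {x y κ : ℝ} (hxy : x ≤ y)
    (h : ∀ z ∈ Set.Icc x y, κ ≤ b z) : κ * (y - x) ≤ ∫ τ in x..y, b τ := by
  have h1 := intervalIntegral.integral_mono_on hxy (intervalIntegrable_const (μ := MeasureTheory.volume) (c := κ))
    (hb.intervalIntegrable x y) h
  rw [intervalIntegral.integral_const, smul_eq_mul] at h1
  linarith

theorem exists_le_on_ball {b : ℝ → ℝ} (hb : Continuous b) {t : ℝ} (ht : 0 < b t) :
    ∃ ε, 0 < ε ∧ ε ≤ 2 * Real.pi ∧ ∀ s, |s - t| ≤ ε → b t / 2 ≤ b s := by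
  obtain ⟨ε, hε, h⟩ := Metric.eventually_nhds_iff.mp
    (hb.continuousAt.eventually (lt_mem_nhds (half_lt_self ht)))
  refine ⟨min (ε / 2) (2 * Real.pi), lt_min (by linarith) Real.two_pi_pos, min_le_right _ _,
    fun s hs => (h ?_).le⟩
  rw [Real.dist_eq]
  have := min_le_left (ε / 2) (2 * Real.pi)
  linarith

/-- Let `b ≤ -κ` within `ε` of `t`. Every `s` in `(t + ε/2, t + ε)` gives `B(t, nξ) - B(s, nξ) ≥ n^m
κ ε/2`, which exceeds the logarithm for large `n`, when the fixed length `ε/2` is also admissible.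
-/
theorem eventually_not_alphaPlus {m : ℕ} (hm : 1 ≤ m) (hhom : IsPosHomogeneous m c)
    {ξ : Fin N → ℤ} (hξ : ξ ≠ 0) (hneg : ∃ t, imSymbol c t ξ < 0) (D : ℝ) :
    ∀ᶠ n : ℕ in Filter.atTop, ¬ AlphaPlus (m : ℝ) c D (n • ξ) := by
  obtain ⟨t', ht'⟩ := hneg
  obtain ⟨t, ht, htt⟩ := (imSymbol_periodic c ξ).exists_mem_Ico Real.two_pi_pos t' 0
  rw [htt] at ht'
  have hc := continuous_imSymbol c ξ
  obtain ⟨ε, hε, hε2, hb⟩ := exists_le_on_ball hc.fun_neg (neg_pos.mpr ht')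
  set κ := -imSymbol c t ξ / 2 with hκ
  have hκ0 : 0 < κ := by linarith
  filter_upwards [eventually_rpow_neg_le hm hξ (half_pos hε),
    eventually_mul_log_lt hm hξ D (mul_pos hκ0 (half_pos hε)),
    Filter.eventually_gt_atTop 0] with n h1 h2 hn hα
  obtain ⟨s, hs, hle⟩ := hα t ⟨ht.1, by linarith [ht.2]⟩ (t + ε / 2) (t + ε) (by linarith)
    (fun s hs => ⟨by linarith [hs.1], by linarith [hs.2]⟩) (h1.trans (by linarith))
  rw [imPrimitive_nsmul hhom ξ hn, imPrimitive_nsmul hhom ξ hn, ← mul_sub, imPrimitive_sub,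
    intervalIntegral.integral_symm, ← intervalIntegral.integral_neg] at hle
  have h3 := mul_sub_le_integral hc.fun_neg (κ := κ) (x := t) (y := s) (by linarith [hs.1])
    (fun z hz => hb z (by
      rw [abs_of_nonneg (by linarith [hz.1])]
      linarith [hz.2, hs.2]))
  have h4 : κ * (ε / 2) ≤ κ * (s - t) :=
    mul_le_mul_of_nonneg_left (by linarith [hs.1]) hκ0.le
  have h5 := mul_le_mul_of_nonneg_left (h4.trans h3) (by positivity : 0 ≤ (n : ℝ) ^ m)
  linarith

/-- The mirror image: `b ≥ κ` near `t` and the interval `(t - ε, t - ε/2)` to its left. -/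
theorem eventually_not_alphaMinus {m : ℕ} (hm : 1 ≤ m) (hhom : IsPosHomogeneous m c)
    {ξ : Fin N → ℤ} (hξ : ξ ≠ 0) (hpos : ∃ t, 0 < imSymbol c t ξ) (D : ℝ) :
    ∀ᶠ n : ℕ in Filter.atTop, ¬ AlphaMinus (m : ℝ) c D (n • ξ) := by
  obtain ⟨t', ht'⟩ := hpos
  obtain ⟨t, ht, htt⟩ := (imSymbol_periodic c ξ).exists_mem_Ico Real.two_pi_pos t' 0
  rw [htt] at ht'
  have hc := continuous_imSymbol c ξ
  obtain ⟨ε, hε, hε2, hb⟩ := exists_le_on_ball hc ht'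
  set κ := imSymbol c t ξ / 2 with hκ
  have hκ0 : 0 < κ := by linarith
  filter_upwards [eventually_rpow_neg_le hm hξ (half_pos hε),
    eventually_mul_log_lt hm hξ D (mul_pos hκ0 (half_pos hε)),
    Filter.eventually_gt_atTop 0] with n h1 h2 hn hα
  obtain ⟨s, hs, hle⟩ := hα t ⟨ht.1, by linarith [ht.2]⟩ (t - ε) (t - ε / 2) (by linarith)
    (fun s hs => ⟨by linarith [hs.1], by linarith [hs.2]⟩) (h1.trans (by linarith))
  rw [imPrimitive_nsmul hhom ξ hn, imPrimitive_nsmul hhom ξ hn, ← mul_sub, imPrimitive_sub] at hle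
  have h3 := mul_sub_le_integral hc (κ := κ) (x := s) (y := t) (by linarith [hs.2])
    (fun z hz => hb z (by
      rw [abs_of_nonpos (by linarith [hz.2])]
      linarith [hz.1, hs.1]))
  have h4 : κ * (ε / 2) ≤ κ * (t - s) :=
    mul_le_mul_of_nonneg_left (by linarith [hs.2]) hκ0.le
  have h5 := mul_le_mul_of_nonneg_left (h4.trans h3) (by positivity : 0 ≤ (n : ℝ) ^ m)
  linarith

theorem not_isGloballySolvable_of_sign_change {m : ℕ} (hm : 1 ≤ m) (hc : IsTubeType c)
    (hhom : IsPosHomogeneous m c) {ξ₀ : Fin N → ℤ} (hξ₀ : ξ₀ ≠ 0)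
    (hZ : ξ₀ ∉ integerAverageSet c) (hneg : ∃ t, imSymbol c t ξ₀ < 0)
    (hpos : ∃ t, 0 < imSymbol c t ξ₀) : ¬ IsGloballySolvable (tubeOperator c) := by
  intro hclosed
  obtain ⟨s, u, hus, husl, hub⟩ := exists_almost_null_modes hm hc hhom hneg hpos
  set S : Set ℕ := {n | 0 < n ∧ n • ξ₀ ∉ integerAverageSet c} with hS
  have hSinf : S.Infinite :=
    Nat.frequently_atTop_iff_infinite.mp (frequently_nsmul_notMem_integerAverageSet hhom hZ)
  have hinj : Function.Injective fun n : ℕ => n • ξ₀ := by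
    obtain ⟨j, hj⟩ := Function.ne_iff.mp hξ₀
    intro a b hab
    have h1 := congrFun hab j
    simp only [Pi.smul_apply, nsmul_eq_mul] at h1
    exact_mod_cast mul_right_cancel₀ hj h1
  choose C hC using hub
  have hsum : Summable fun n : ℕ => ((n : ℝ) ^ 2)⁻¹ := by
    simp
  obtain ⟨G, hG, -⟩ := exists_hasSum (g := fun n : S => tubeOperator c (u n))
    (v := fun k n => C k * (((n : ℕ) : ℝ) ^ 2)⁻¹)
    (fun k => (hsum.mul_left (C k)).subtype S) (fun k n => hC k n n.2.1)
  -- Only finite sums of the `u n` are used as preimages; closedness of the range supplies the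
  -- limit.
  have hGmem : G ∈ Set.range (tubeOperator c) := by
    refine hclosed.mem_of_tendsto hG (Filter.Eventually.of_forall fun F => ?_)
    exact ⟨∑ n ∈ F, u n, map_sum _ _ _⟩
  obtain ⟨v, hv⟩ := hGmem
  have hcoef : ∀ n : S, partialCoef s ((n : ℕ) • ξ₀) v = 1 := by
    intro n
    rw [← hus n]
    refine hc.partialCoef_eq_of_tubeOperator n.2.2 (fun t => ?_) s
    rw [hv]
    -- The modes have distinct `x`-frequencies, since `ξ₀ ≠ 0`, so only the `n`-th term contributes.
    have h1 := (partialCoef t ((n : ℕ) • ξ₀)).hasSum hG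
    refine h1.unique (hasSum_single n fun k hk => ?_)
    obtain ⟨a, ha⟩ := husl k t
    have hne : (k : ℕ) • ξ₀ ≠ (n : ℕ) • ξ₀ := fun h => hk (Subtype.ext (hinj h))
    rw [partialCoef_apply, ha, coef_smul, coef_torusExp_of_ne hne, mul_zero]
  have hsv := (summable_norm_coef (slice s v)).comp_injective
    (hinj.comp (Subtype.val_injective (p := (· ∈ S))))
  have : Infinite S := hSinf.to_subtype
  have h2 : ∀ n : S, ‖coef ((n : ℕ) • ξ₀) (slice s v)‖ = 1 := fun n => by
    rw [← partialCoef_apply, hcoef n, norm_one]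
  -- Summable coefficients tend to zero, yet along the infinite set `S` they all have modulus `1`.
  have h3 := hsv.tendsto_cofinite_zero.congr h2
  exact one_ne_zero (tendsto_const_nhds_iff.mp h3)

end

end

theorem mainTheorem4 (N m : ℕ) (hm : 1 ≤ m)
    (c : TorusSmooth (N + 1) →L[ℂ] TorusSmooth (N + 1))
    (htube : IsTubeType c) (hhom : IsPosHomogeneous m c)
    (ξ₀ : Fin N → ℤ) (hξ₀ : ξ₀ ≠ 0) (hZ : ξ₀ ∉ integerAverageSet c)
    (hsign : (∃ t : ℝ, imSymbol c t ξ₀ < 0) ∧ (∃ t : ℝ, 0 < imSymbol c t ξ₀)) :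
    ¬ IsGloballySolvable (tubeOperator c) ∧
      ∀ D : ℝ, 0 < D →
        {n : ℕ | 0 < n ∧ n • ξ₀ ∉ integerAverageSet c ∧
          ¬ AlphaPlus (m : ℝ) c D (n • ξ₀) ∧ ¬ AlphaMinus (m : ℝ) c D (n • ξ₀)}.Infinite := by
  refine ⟨not_isGloballySolvable_of_sign_change hm htube hhom hξ₀ hZ hsign.1 hsign.2, fun D _ => ?_⟩
  refine Nat.frequently_atTop_iff_infinite.mp ?_
  refine ((frequently_nsmul_notMem_integerAverageSet hhom hZ).and_eventually
    ((eventually_not_alphaPlus hm hhom hξ₀ hsign.1 D).and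
      (eventually_not_alphaMinus hm hhom hξ₀ hsign.2 D))).mono fun n hn => ?_
  exact ⟨hn.1.1, hn.1.2, hn.2⟩
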